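/- **Setting.** Let $\widehat{\mathbb Z}=\prod_p\mathbb Z_p$ be the compact ring of finite integral adeles, $\widehat{\mathbb Z}^*$ its group of units, and $\widehat{\mathbb Z}/\widehat{\mathbb Z}^*$ the orbit space for multiplication, with the quotient topology. Let $\Omega_B=\{(r,a): a\in\widehat{\mathbb Z}/\widehat{\mathbb Z}^*,\ r\in\widehat{\mathbb Z}/a\widehat{\mathbb Z}\}$, with the quotient topology from the canonical surjection $p\colon\widehat{\mathbb Z}\times(\widehat{\mathbb Z}/\widehat{\mathbb Z}^*)\to\Omega_B$. The semigroup $S=\mathbb Z\rtimes\mathbb N^\times$, with product $(m,k)(n,l)=(m+kn,kl)$, acts on $\Omega_B$ by $(m,k)(r,a)=(m+kr,ka)$; this action is by injective maps with clopen images. Let $C(\Omega_B)\rtimes S$ be the universal unital C$^*$-algebra generated by a unital $*$-homomorphic image $\iota(C(\Omega_B))$ and isometries $v_x$, $x\in S$, with $v_xv_y=v_{xy}$ and $v_x\iota(f)v_x^*=\iota(f(x^{-1}\cdot))$, where $f(x^{-1}\cdot)$ is extended by $0$ outside $x\Omega_B$. Let $\sigma$ be its dynamics given by $\sigma_t(\iota(f))=\iota(f)$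 and $\sigma_t(v_{(m,k)})=k^{it}v_{(m,k)}$. For $\beta\in\mathbb R$, a $\sigma$-KMS$_\beta$-state is a $\sigma$-invariant state $\varphi$ with $\varphi(ab)=\varphi(b\,\sigma_{i\beta}(a))$ for all $\sigma$-analytic $a,b$. For $\beta\in\mathbb R$, a probability measure $\mu$ on (the Borel sets of) $\Omega_B$ satisfies the scaling condition at $\beta$ if $$\mu((m,n)Y)=n^{-\beta}\mu(Y)\quad\text{for all Borel } Y\subset\Omega_B\text{ and all }(m,n)\in\mathbb Z\rtimes\mathbb N^\times.\qquad(*)$$ For $s\ge0$ let $\bar\nu_s$ be the symmetric Bost–Connes measure on $\widehat{\mathbb Z}/\widehat{\mathbb Z}^*=\prod_p\mathbb Z_p/\mathbb Z_p^*$ at inverse temperature $s$: $\bar\nu_0$ is the point mass at $0$, and for $s>0$, $\bar\nu_s=\prod_p\bar\nu_{s,p}$ where $\bar\nu_{s,p}(p^n\mathbb Z_p^*)=p^{-ns}(1-p^{-s})$ for $n\ge 0$ and $\bar\nu_{s,p}(\{0\})=0$. **Proposition.** 1. For every $\beta\ge1$ there is a unique probability measure $\mu_\beta$ on $\Omega_B$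 satisfying $(*)$. For $\beta<1$ there is no such measure. 2. For every $\beta\ge1$, $\bar\nu_{\beta-1}$ is the unique probability measure $\nu$ on $\widehat{\mathbb Z}/\widehat{\mathbb Z}^*$ such that $\nu(nY)=n^{-(\beta-1)}\nu(Y)$ for all Borel $Y$ and all $n\in\mathbb N^\times$, and $\mu_\beta=p_*(\nu_1\times\bar\nu_{\beta-1})$, where $\nu_1$ is the Haar probability measure on $\widehat{\mathbb Z}$. 3. There is a unique bounded linear map $E\colon C(\Omega_B)\rtimes S\to C(\Omega_B)$ with $E\circ\iota=\mathrm{id}$, $\|E\|\le1$, $E(v_x^*\iota(f)v_x)=f(x\,\cdot)$, and $E(v_x^*\iota(f)v_y)=0$ for $x\ne y$ (the canonical conditional expectation). For every $\beta\in\mathbb R$ and every probability measure $\mu$ on $\Omega_B$, the functional $a\mapsto\int_{\Omega_B}E(a)\,d\mu$ is a $\sigma$-KMS$_\beta$-state if and only if $\mu$ satisfies $(*)$. Equivalently to part 1, for every $\beta\ge1$ there is a unique $\sigma$-KMS$_\beta$-state on $C(\Omega_B)\rtimes S$ which factors through $E$. For $\beta<1$ there are no $\sigma$-KMS$_\beta$-states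 at all. -/

import Mathlib

open MeasureTheory Complex
open scoped ENNReal ContinuousMap

noncomputable section

namespace AffineBC

/-! ## The semigroup crossed product as a universal C⋆-algebra

`X` is a compact space and `S` a monoid acting on `X` by injective continuous maps. -/

/-- A covariant representation of `(X, S)` in a unital C⋆-algebra `B`: a unital ⋆-homomorphism
`ι` of `C(X)` and a representation `v` of the monoid `S` by isometries such that
`v x * ι f * (v x)⋆ = ι (f (x⁻¹ ·))`. Here `f (x⁻¹ ·)` is the function whose value at `x • ω` is
`f ω` and which vanishes outside `x • X`, that is, `Function.extend (x • ·) f 0`. -/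
structure CovariantRep (X S : Type) [TopologicalSpace X] [CompactSpace X] [Monoid S]
    [MulAction S X] (B : Type) [CStarAlgebra B] where
  ι : C(X, ℂ) →⋆ₐ[ℂ] B
  v : S →* B
  isometry : ∀ x : S, star (v x) * v x = 1
  covariant : ∀ (x : S) (f g : C(X, ℂ)),
    (g : X → ℂ) = Function.extend (fun ω : X => x • ω) f 0 → v x * ι f * star (v x) = ι g

/-- Formal ⋆-polynomial expressions in the generators of the crossed product. -/
inductive Expr (X S : Type) [TopologicalSpace X] : Type
  | fn (f : C(X, ℂ)) : Expr X S
  | iso (x : S) : Expr X S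
  | const (c : ℂ) : Expr X S
  | add (a b : Expr X S) : Expr X S
  | mul (a b : Expr X S) : Expr X S
  | adj (a : Expr X S) : Expr X S

section CrossedProduct

variable {X S : Type} [TopologicalSpace X] [CompactSpace X] [Monoid S] [MulAction S X]

/-- The value of a formal expression in a covariant representation. -/
def CovariantRep.eval {B : Type} [CStarAlgebra B] (ρ : CovariantRep X S B) : Expr X S → B
  | .fn f => ρ.ι f
  | .iso x => ρ.v x
  | .const c => algebraMap ℂ B c
  | .add a b => ρ.eval a + ρ.eval b
  | .mul a b => ρ.eval a * ρ.eval b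
  | .adj a => star (ρ.eval a)

variable (X S)

/-- The set of all functions `a ↦ ‖ρ(a)‖` on formal expressions, for `ρ` a covariant
representation in a nonzero C⋆-algebra. It serves as a (small) index set for a family of covariant
representations which contains every covariant representation up to isomorphism of the
C⋆-algebras generated. -/
def repNorms : Set (Expr X S → ℝ) :=
  {q | ∃ (B : Type) (_ : CStarAlgebra B) (_ : Nontrivial B) (ρ : CovariantRep X S B),
    q = fun a => ‖ρ.eval a‖}

variable {X S}

/-- A C⋆-algebra carrying a covariant representation with the given norm function. -/
def RepAlg (q : repNorms X S) : Type := q.2.choose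

instance (q : repNorms X S) : CStarAlgebra (RepAlg q) := q.2.choose_spec.choose

instance (q : repNorms X S) : Nontrivial (RepAlg q) := q.2.choose_spec.choose_spec.choose

/-- A covariant representation with the given norm function. -/
def repOf (q : repNorms X S) : CovariantRep X S (RepAlg q) :=
  q.2.choose_spec.choose_spec.choose_spec.choose

theorem norm_eval_repOf (q : repNorms X S) (a : Expr X S) : ‖(repOf q).eval a‖ = q.1 a :=
  (congrFun q.2.choose_spec.choose_spec.choose_spec.choose_spec a).symm

variable (X S)

/-- The C⋆-algebra of bounded families `(b q)` with `b q ∈ RepAlg q`. -/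
abbrev BigProd : Type := lp (fun q : repNorms X S => RepAlg q) ∞

instance : CStarAlgebra (BigProd X S) where

variable {X S}

/-- The bounded family with given coordinates. -/
def BigProd.mk (b : ∀ q : repNorms X S, RepAlg q) (C : ℝ) (h : ∀ q, ‖b q‖ ≤ C) : BigProd X S :=
  ⟨b, memℓp_infty ⟨C, by rintro _ ⟨q, rfl⟩; exact h q⟩⟩

/-- The coordinates of a bounded family. -/
def BigProd.coord (q : repNorms X S) : BigProd X S →⋆ₐ[ℂ] RepAlg q where
  toFun b := b q
  map_one' := rfl
  map_mul' _ _ := rfl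
  map_zero' := rfl
  map_add' _ _ := rfl
  commutes' _ := rfl
  map_star' _ := rfl

theorem BigProd.coord_mk (b : ∀ q : repNorms X S, RepAlg q) (C : ℝ) (h : ∀ q, ‖b q‖ ≤ C)
    (q : repNorms X S) : BigProd.coord q (BigProd.mk b C h) = b q := rfl

theorem BigProd.ext {a b : BigProd X S} (h : ∀ q, BigProd.coord q a = BigProd.coord q b) :
    a = b :=
  lp.ext (funext h)

theorem BigProd.norm_coord_le (q : repNorms X S) (a : BigProd X S) : ‖BigProd.coord q a‖ ≤ ‖a‖ :=
  lp.norm_apply_le_norm ENNReal.top_ne_zero a q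

theorem CovariantRep.norm_ι_le {B : Type} [CStarAlgebra B] (ρ : CovariantRep X S B)
    (f : C(X, ℂ)) : ‖ρ.ι f‖ ≤ ‖f‖ :=
  NonUnitalStarAlgHom.norm_apply_le ρ.ι f

theorem CovariantRep.norm_v_le {B : Type} [CStarAlgebra B] (ρ : CovariantRep X S B)
    (x : S) : ‖ρ.v x‖ ≤ 1 := by
  have h : ‖ρ.v x‖ * ‖ρ.v x‖ ≤ 1 := by
    rw [← CStarRing.norm_star_mul_self, ρ.isometry]
    rcases subsingleton_or_nontrivial B with hB | hB
    · rw [Subsingleton.elim (1 : B) 0, norm_zero]; exact zero_le_one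
    · rw [CStarRing.norm_one]
  nlinarith [norm_nonneg (ρ.v x)]

variable (X S)

/-- The direct sum of all covariant representations in the family. -/
def bigRep : CovariantRep X S (BigProd X S) where
  ι :=
    { toFun := fun f => BigProd.mk (fun q => (repOf q).ι f) ‖f‖ (fun q => (repOf q).norm_ι_le f)
      map_one' := BigProd.ext fun q => by simp [BigProd.coord_mk]
      map_mul' := fun f g => BigProd.ext fun q => by simp [BigProd.coord_mk]
      map_zero' := BigProd.ext fun q => by simp [BigProd.coord_mk]
      map_add' := fun f g => BigProd.ext fun q => by simp [BigProd.coord_mk]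
      commutes' := fun c => BigProd.ext fun q => by
        rw [BigProd.coord_mk, AlgHomClass.commutes, AlgHomClass.commutes]
      map_star' := fun f => BigProd.ext fun q => by simp [BigProd.coord_mk, map_star] }
  v :=
    { toFun := fun x => BigProd.mk (fun q => (repOf q).v x) 1 (fun q => (repOf q).norm_v_le x)
      map_one' := BigProd.ext fun q => by simp [BigProd.coord_mk]
      map_mul' := fun x y => BigProd.ext fun q => by simp [BigProd.coord_mk] }
  isometry x := BigProd.ext fun q => by
    simpa [BigProd.coord_mk, map_star] using (repOf q).isometry x
  covariant x f g h := BigProd.ext fun q => by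
    simpa [BigProd.coord_mk, map_star] using (repOf q).covariant x f g h

variable {X S}

/-- The generators of the C⋆-algebra generated by a covariant representation. -/
def CovariantRep.gens {B : Type} [CStarAlgebra B] (ρ : CovariantRep X S B) : Set B :=
  Set.range ρ.ι ∪ Set.range ρ.v

variable (X S)

/-- The C⋆-algebra generated by the direct sum of all covariant representations. -/
def crossedSubalgebra : StarSubalgebra ℂ (BigProd X S) :=
  (StarAlgebra.adjoin ℂ (bigRep X S).gens).topologicalClosure

/-- The crossed product `C(X) ⋊ S`: the universal unital C⋆-algebra generated by a covariant
representation of `(X, S)`; see `CrossedProduct.existsUnique_lift` for the universal property. -/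
def CrossedProduct : Type := crossedSubalgebra X S

instance : CStarAlgebra (CrossedProduct X S) :=
  StarSubalgebra.cstarAlgebra (crossedSubalgebra X S)
    (h_closed := StarSubalgebra.isClosed_topologicalClosure _)

namespace CrossedProduct

/-- The inclusion into the bounded families. -/
def incl : CrossedProduct X S →⋆ₐ[ℂ] BigProd X S := (crossedSubalgebra X S).subtype

theorem isometry_incl : Isometry (incl X S) := isometry_subtype_coe

theorem ι_mem (f : C(X, ℂ)) : (bigRep X S).ι f ∈ crossedSubalgebra X S :=
  StarSubalgebra.le_topologicalClosure _ (StarAlgebra.subset_adjoin _ _ (Or.inl ⟨f, rfl⟩))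

theorem v_mem (x : S) : (bigRep X S).v x ∈ crossedSubalgebra X S :=
  StarSubalgebra.le_topologicalClosure _ (StarAlgebra.subset_adjoin _ _ (Or.inr ⟨x, rfl⟩))

/-- The universal covariant representation. -/
def univ : CovariantRep X S (CrossedProduct X S) where
  ι := (bigRep X S).ι.codRestrict (crossedSubalgebra X S) (ι_mem X S)
  v :=
    { toFun := fun x => (⟨(bigRep X S).v x, v_mem X S x⟩ : crossedSubalgebra X S)
      map_one' := Subtype.ext (map_one (bigRep X S).v)
      map_mul' := fun x y => Subtype.ext (map_mul (bigRep X S).v x y) }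
  isometry x := Subtype.ext ((bigRep X S).isometry x)
  covariant x f g h := Subtype.ext ((bigRep X S).covariant x f g h)

variable {X S}

/-- The canonical homomorphism `C(X) → C(X) ⋊ S`. -/
abbrev ι : C(X, ℂ) →⋆ₐ[ℂ] CrossedProduct X S := (univ X S).ι

/-- The canonical isometries of `C(X) ⋊ S`. -/
abbrev v : S →* CrossedProduct X S := (univ X S).v

theorem coord_eval (q : repNorms X S) (a : Expr X S) :
    BigProd.coord q (incl X S ((univ X S).eval a)) = (repOf q).eval a := by
  induction a with
  | fn f => rfl
  | iso x => rfl
  | const c => rfl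
  | add a b ha hb => simp only [CovariantRep.eval, map_add, ha, hb]
  | mul a b ha hb => simp only [CovariantRep.eval, map_mul, ha, hb]
  | adj a ha => simp only [CovariantRep.eval, map_star, ha]

/-- Every covariant representation is dominated by the universal one. -/
theorem norm_eval_le {B : Type} [CStarAlgebra B] (ρ : CovariantRep X S B) (a : Expr X S) :
    ‖ρ.eval a‖ ≤ ‖(univ X S).eval a‖ := by
  rcases subsingleton_or_nontrivial B with hB | hB
  · rw [Subsingleton.elim (ρ.eval a) 0, norm_zero]; exact norm_nonneg _
  · let q : repNorms X S := ⟨fun a => ‖ρ.eval a‖, B, inferInstance, hB, ρ, rfl⟩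
    have h1 : ‖(repOf q).eval a‖ = ‖ρ.eval a‖ := norm_eval_repOf q a
    rw [← h1, ← coord_eval]
    refine (BigProd.norm_coord_le q _).trans (le_of_eq ?_)
    simpa using (isometry_incl X S).norm_map_of_map_zero (map_zero _) ((univ X S).eval a)

/-- Elements of the ⋆-algebra generated by a covariant representation are values of formal
expressions. -/
theorem exists_eval_eq {B : Type} [CStarAlgebra B] (ρ : CovariantRep X S B) {z : B}
    (hz : z ∈ StarAlgebra.adjoin ℂ ρ.gens) : ∃ a, ρ.eval a = z := by
  induction hz using StarAlgebra.adjoin_induction with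
  | mem z hz =>
    rcases hz with ⟨f, rfl⟩ | ⟨x, rfl⟩
    · exact ⟨.fn f, rfl⟩
    · exact ⟨.iso x, rfl⟩
  | algebraMap c => exact ⟨.const c, rfl⟩
  | add z w _ _ hz hw =>
    obtain ⟨⟨a, rfl⟩, ⟨b, rfl⟩⟩ := And.intro hz hw
    exact ⟨.add a b, rfl⟩
  | mul z w _ _ hz hw =>
    obtain ⟨⟨a, rfl⟩, ⟨b, rfl⟩⟩ := And.intro hz hw
    exact ⟨.mul a b, rfl⟩
  | star z _ hz =>
    obtain ⟨a, rfl⟩ := hz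
    exact ⟨.adj a, rfl⟩

/-- Evaluation of expressions is compatible with ⋆-homomorphisms. -/
theorem map_eval {B C : Type} [CStarAlgebra B] [CStarAlgebra C] (ρ : CovariantRep X S B)
    (τ : CovariantRep X S C) (π : B →⋆ₐ[ℂ] C) (hι : ∀ f, π (ρ.ι f) = τ.ι f)
    (hv : ∀ x, π (ρ.v x) = τ.v x) (a : Expr X S) : π (ρ.eval a) = τ.eval a := by
  induction a with
  | fn f => exact hι f
  | iso x => exact hv x
  | const c => exact AlgHomClass.commutes π c
  | add a b ha hb => simp only [CovariantRep.eval, map_add, ha, hb]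
  | mul a b ha hb => simp only [CovariantRep.eval, map_mul, ha, hb]
  | adj a ha => simp only [CovariantRep.eval, map_star, ha]

/-- The values of expressions are dense in the crossed product. -/
theorem dense_range_eval : DenseRange (univ X S).eval := by
  intro z
  have hz : incl X S z ∈ closure (StarAlgebra.adjoin ℂ (bigRep X S).gens : Set (BigProd X S)) :=
    Subtype.prop (p := (· ∈ crossedSubalgebra X S)) z
  rw [(isometry_incl X S).isUniformInducing.isInducing.closure_eq_preimage_closure_image]
  refine closure_mono ?_ hz
  intro w hw
  obtain ⟨a, rfl⟩ := exists_eval_eq (bigRep X S) hw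
  exact ⟨_, ⟨a, rfl⟩, map_eval (univ X S) (bigRep X S) (incl X S) (fun _ => rfl)
    (fun _ => rfl) a⟩

theorem continuous_hom {B C : Type} [CStarAlgebra B] [CStarAlgebra C] (π : B →⋆ₐ[ℂ] C) :
    Continuous π :=
  AddMonoidHomClass.continuous_of_bound π 1 fun x => by
    simpa using NonUnitalStarAlgHom.norm_apply_le π x

/-- The direct sum of two covariant representations. -/
def prodRep {B C : Type} [CStarAlgebra B] [CStarAlgebra C] (ρ : CovariantRep X S B)
    (τ : CovariantRep X S C) : CovariantRep X S (B × C) where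
  ι := ρ.ι.prod τ.ι
  v := ρ.v.prod τ.v
  isometry x := Prod.ext (ρ.isometry x) (τ.isometry x)
  covariant x f g h := Prod.ext (ρ.covariant x f g h) (τ.covariant x f g h)

/-- **Universal property of the crossed product**: every covariant representation of `(X, S)` in
a unital C⋆-algebra `B` extends uniquely to a unital ⋆-homomorphism `C(X) ⋊ S → B`. -/
theorem existsUnique_lift {B : Type} [CStarAlgebra B] (ρ : CovariantRep X S B) :
    ∃! π : CrossedProduct X S →⋆ₐ[ℂ] B, (∀ f, π (ι f) = ρ.ι f) ∧ ∀ x : S, π (v x) = ρ.v x := by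
  refine existsUnique_of_exists_of_unique ?_ ?_
  · let P := prodRep (univ X S) ρ
    let D : StarSubalgebra ℂ (CrossedProduct X S × B) :=
      (StarAlgebra.adjoin ℂ P.gens).topologicalClosure
    have hD : ∀ z ∈ D, ‖z.2‖ ≤ ‖z.1‖ := by
      intro z hz
      have hcl : IsClosed {z : CrossedProduct X S × B | ‖z.2‖ ≤ ‖z.1‖} :=
        isClosed_le continuous_snd.norm continuous_fst.norm
      refine closure_minimal ?_ hcl (hz : z ∈ closure (StarAlgebra.adjoin ℂ P.gens : Set _))
      intro w hw
      obtain ⟨a, rfl⟩ := exists_eval_eq P hw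
      have h1 : (P.eval a).1 = (univ X S).eval a :=
        map_eval P (univ X S) (StarAlgHom.fst ℂ _ _) (fun _ => rfl) (fun _ => rfl) a
      have h2 : (P.eval a).2 = ρ.eval a :=
        map_eval P ρ (StarAlgHom.snd ℂ _ _) (fun _ => rfl) (fun _ => rfl) a
      change ‖(P.eval a).2‖ ≤ ‖(P.eval a).1‖
      rw [h1, h2]
      exact norm_eval_le ρ a
    have hDcl : IsClosed (D : Set (CrossedProduct X S × B)) :=
      StarSubalgebra.isClosed_topologicalClosure _
    have hmem : ∀ a, P.eval a ∈ D := by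
      intro a
      refine StarSubalgebra.le_topologicalClosure _ ?_
      induction a with
      | fn f => exact StarAlgebra.subset_adjoin _ _ (Or.inl ⟨f, rfl⟩)
      | iso x => exact StarAlgebra.subset_adjoin _ _ (Or.inr ⟨x, rfl⟩)
      | const c => exact algebraMap_mem _ c
      | add a b ha hb => exact add_mem ha hb
      | mul a b ha hb => exact mul_mem ha hb
      | adj a ha => exact star_mem ha
    let π₁ : D →⋆ₐ[ℂ] CrossedProduct X S := (StarAlgHom.fst ℂ _ _).comp D.subtype
    let π₂ : D →⋆ₐ[ℂ] B := (StarAlgHom.snd ℂ _ _).comp D.subtype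
    have hiso : Isometry π₁ := by
      refine AddMonoidHomClass.isometry_of_norm π₁ fun z => ?_
      exact (max_eq_left (hD z.1 z.2)).symm
    have hcs : CompleteSpace D := hDcl.completeSpace_coe
    have hrange : IsClosed (Set.range π₁) := hiso.isClosedEmbedding.isClosed_range
    have hsurj : Function.Surjective π₁ := by
      intro z
      have hz : z ∈ closure (Set.range (univ X S).eval) := dense_range_eval z
      refine closure_minimal ?_ hrange hz
      rintro _ ⟨a, rfl⟩
      exact ⟨⟨P.eval a, hmem a⟩,
        map_eval P (univ X S) (StarAlgHom.fst ℂ _ _) (fun _ => rfl) (fun _ => rfl) a⟩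
    let e : D ≃⋆ₐ[ℂ] CrossedProduct X S := StarAlgEquiv.ofBijective π₁ ⟨hiso.injective, hsurj⟩
    have he : ∀ z : D, e.symm (π₁ z) = z := fun z => e.symm_apply_apply z
    refine ⟨π₂.comp (e.symm : CrossedProduct X S →⋆ₐ[ℂ] D), fun f => ?_, fun x => ?_⟩
    · exact congrArg π₂ (he ⟨P.ι f, hmem (.fn f)⟩)
    · exact congrArg π₂ (he ⟨P.v x, hmem (.iso x)⟩)
  · rintro π π' ⟨hι, hv⟩ ⟨hι', hv'⟩
    have h : (π : CrossedProduct X S → B) = π' := by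
      refine dense_range_eval.equalizer (continuous_hom π) (continuous_hom π') (funext fun a => ?_)
      exact (map_eval (univ X S) ρ π hι hv a).trans (map_eval (univ X S) ρ π' hι' hv' a).symm
    exact DFunLike.coe_injective h

/-- The homomorphism out of the crossed product given by a covariant representation. -/
def lift {B : Type} [CStarAlgebra B] (ρ : CovariantRep X S B) : CrossedProduct X S →⋆ₐ[ℂ] B :=
  (existsUnique_lift ρ).choose

/-- The universal covariant representation with the isometries multiplied by a character. -/
def twistRep (χ : S →* Circle) : CovariantRep X S (CrossedProduct X S) where
  ι := ι
  v :=
    { toFun := fun x => (χ x : ℂ) • v x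
      map_one' := by simp
      map_mul' := fun x y => by simp [mul_smul, smul_comm (χ x : ℂ)] }
  isometry x := by
    have h : star (χ x : ℂ) * (χ x : ℂ) = 1 := by
      rw [Complex.star_def, Complex.conj_mul', Circle.norm_coe]; simp
    simp only [MonoidHom.coe_mk, OneHom.coe_mk]
    rw [star_smul, smul_mul_smul_comm, h, one_smul, (univ X S).isometry]
  covariant x f g hfg := by
    have h : (χ x : ℂ) * star (χ x : ℂ) = 1 := by
      rw [Complex.star_def, Complex.mul_conj', Circle.norm_coe]; simp
    simp only [MonoidHom.coe_mk, OneHom.coe_mk]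
    rw [star_smul, smul_mul_assoc, smul_mul_smul_comm, h, one_smul,
      (univ X S).covariant x f g hfg]

/-- The endomorphism of the crossed product which is the identity on `C(X)` and multiplies the
isometry `v x` by `χ x`. -/
def gauge (χ : S →* Circle) : CrossedProduct X S →⋆ₐ[ℂ] CrossedProduct X S := lift (twistRep χ)

/-- The defining properties of the canonical conditional expectation `C(X) ⋊ S → C(X)`: a
projection of norm one onto `C(X)` which maps `(v x)⋆ * ι f * v y` to `0` for `x ≠ y` and to
`(v x)⋆ * ι f * v x = ι (f (x ·))` for `x = y`. -/
structure IsCanonicalExpectation [ContinuousConstSMul S X]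
    (E : CrossedProduct X S →L[ℂ] C(X, ℂ)) : Prop where
  map_ι : ∀ f : C(X, ℂ), E (ι f) = f
  norm_le : ∀ a, ‖E a‖ ≤ ‖a‖
  map_self : ∀ (x : S) (f : C(X, ℂ)),
    E (star (v x) * ι f * v x) = f.comp ⟨fun ω : X => x • ω, continuous_const_smul x⟩
  map_ne : ∀ (x y : S) (f : C(X, ℂ)), x ≠ y → E (star (v x) * ι f * v y) = 0

end CrossedProduct

end CrossedProduct
/-! ## The semigroup `ℤ ⋊ ℕˣ` -/

/-- The semidirect product `ℤ ⋊ ℕˣ`, with `(m, k) (n, l) = (m + k n, k l)`. -/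
@[ext] structure AffSemigroup : Type where
  trans : ℤ
  scale : ℕ+

namespace AffSemigroup

instance : Monoid AffSemigroup where
  mul x y := ⟨x.trans + (x.scale : ℕ) * y.trans, x.scale * y.scale⟩
  one := ⟨0, 1⟩
  mul_assoc x y z := by
    refine AffSemigroup.ext ?_ (mul_assoc _ _ _)
    change x.trans + (x.scale : ℕ) * y.trans + ((x.scale * y.scale : ℕ+) : ℕ) * z.trans
      = x.trans + (x.scale : ℕ) * (y.trans + (y.scale : ℕ) * z.trans)
    push_cast
    ring
  one_mul x := by
    refine AffSemigroup.ext ?_ (one_mul _)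
    change (0 : ℤ) + ((1 : ℕ+) : ℕ) * x.trans = x.trans
    simp
  mul_one x := by
    refine AffSemigroup.ext ?_ (mul_one _)
    change x.trans + (x.scale : ℕ) * (0 : ℤ) = x.trans
    simp

theorem mul_trans (x y : AffSemigroup) : (x * y).trans = x.trans + (x.scale : ℕ) * y.trans := rfl

theorem mul_scale (x y : AffSemigroup) : (x * y).scale = x.scale * y.scale := rfl

theorem one_trans : (1 : AffSemigroup).trans = 0 := rfl

theorem one_scale : (1 : AffSemigroup).scale = 1 := rfl

/-- The character `(m, k) ↦ k ^ (i t)` of `ℤ ⋊ ℕˣ`. -/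
def character (t : ℝ) : AffSemigroup →* Circle where
  toFun x := Circle.exp (t * Real.log (x.scale : ℕ))
  map_one' := by simp [one_scale]
  map_mul' x y := by
    rw [mul_scale, ← Circle.exp_add, PNat.mul_coe, Nat.cast_mul,
      Real.log_mul (Nat.cast_ne_zero.2 x.scale.ne_zero) (Nat.cast_ne_zero.2 y.scale.ne_zero),
      mul_add]

end AffSemigroup

/-! ## Integral adeles and supernatural numbers -/

/-- The set of prime numbers. -/
abbrev PrimeNumber : Type := {p : ℕ // p.Prime}

instance (p : PrimeNumber) : Fact (p : ℕ).Prime := ⟨p.2⟩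

instance (p : PrimeNumber) : MeasurableSpace ℤ_[(p : ℕ)] := borel _

instance (p : PrimeNumber) : BorelSpace ℤ_[(p : ℕ)] := ⟨rfl⟩

/-- The compact ring `∏ₚ ℤₚ` of finite integral adeles. -/
abbrev ZHat : Type := (p : PrimeNumber) → ℤ_[(p : ℕ)]

/-- The orbit space of the group of units of `ZHat` acting on `ZHat` by multiplication, with the
quotient topology; it is identified with the set of supernatural numbers. -/
def SupNat : Type := MulAction.orbitRel.Quotient ZHatˣ ZHat

namespace SupNat

instance : TopologicalSpace SupNat :=
  inferInstanceAs (TopologicalSpace (Quotient (MulAction.orbitRel ZHatˣ ZHat)))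

instance : MeasurableSpace SupNat := borel _

instance : BorelSpace SupNat := ⟨rfl⟩

/-- The class of an integral adele. -/
def mk (a : ZHat) : SupNat := Quotient.mk (MulAction.orbitRel ZHatˣ ZHat) a

theorem continuous_mk : Continuous mk := continuous_quotient_mk'

theorem mk_surjective : Function.Surjective mk := Quotient.mk_surjective

theorem mk_eq_mk {a b : ZHat} : mk a = mk b ↔ ∃ u : ZHatˣ, u * b = a :=
  Quotient.eq.trans Iff.rfl

theorem dvd_of_mk_eq {a b : ZHat} (h : mk a = mk b) : a ∣ b := by
  obtain ⟨u, rfl⟩ := mk_eq_mk.1 h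
  exact ⟨(u⁻¹ : ZHatˣ), by rw [mul_right_comm]; simp⟩

/-- Multiplication of supernatural numbers by positive integers. -/
instance : MulAction ℕ+ SupNat where
  smul k := Quotient.map (fun a : ZHat => ((k : ℕ) : ZHat) * a) (by
    rintro _ b ⟨u, rfl⟩
    exact ⟨u, mul_left_comm (u : ZHat) _ b⟩)
  one_smul a := by
    obtain ⟨a, rfl⟩ := mk_surjective a
    exact congrArg mk (by simp)
  mul_smul k l a := by
    obtain ⟨a, rfl⟩ := mk_surjective a
    exact congrArg mk (by simp [mul_assoc])

theorem smul_mk (k : ℕ+) (a : ZHat) : k • mk a = mk ((k : ℕ) * a) := rfl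

end SupNat

/-! ## The space `Ω_B` -/

/-- The equivalence relation on `ZHat × SupNat` given by `(r, a) ∼ (r', a')` if and only if
`a = a'` and `r - r' ∈ a ZHat`. -/
def omegaSetoid : Setoid (ZHat × SupNat) where
  r x y := x.2 = y.2 ∧ ∃ a : ZHat, SupNat.mk a = x.2 ∧ a ∣ x.1 - y.1
  iseqv :=
    { refl := fun x => by
        obtain ⟨a, ha⟩ := SupNat.mk_surjective x.2
        exact ⟨rfl, a, ha, by simp⟩
      symm := by
        rintro x y ⟨h, a, ha, hd⟩
        exact ⟨h.symm, a, ha.trans h, by rw [← neg_sub]; exact (dvd_neg).2 hd⟩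
      trans := by
        rintro x y z ⟨h, a, ha, hd⟩ ⟨h', b, hb, hd'⟩
        refine ⟨h.trans h', a, ha, ?_⟩
        have hab : a ∣ b := SupNat.dvd_of_mk_eq (ha.trans (h.trans hb.symm))
        have := dvd_add hd (hab.trans hd')
        rwa [sub_add_sub_cancel] at this }

/-- The space `Ω_B` of pairs `(r, a)` with `a ∈ SupNat` and `r ∈ ZHat / a ZHat`, with the quotient
topology. -/
def OmegaB : Type := Quotient omegaSetoid

namespace OmegaB

instance : TopologicalSpace OmegaB := inferInstanceAs (TopologicalSpace (Quotient omegaSetoid))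

instance : CompactSpace SupNat :=
  inferInstanceAs (CompactSpace (Quotient (MulAction.orbitRel ZHatˣ ZHat)))

instance : CompactSpace OmegaB := inferInstanceAs (CompactSpace (Quotient omegaSetoid))

instance : MeasurableSpace OmegaB := borel _

instance : BorelSpace OmegaB := ⟨rfl⟩

/-- The quotient map onto `Ω_B`. -/
def proj (x : ZHat × SupNat) : OmegaB := Quotient.mk omegaSetoid x

theorem continuous_proj : Continuous proj := continuous_quotient_mk'

theorem proj_surjective : Function.Surjective proj := Quotient.mk_surjective

/-- The transformation `(r, a) ↦ (m + k r, k a)` before passing to the quotient. -/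
def preAct (x : AffSemigroup) (y : ZHat × SupNat) : ZHat × SupNat :=
  ((x.trans : ZHat) + ((x.scale : ℕ) : ZHat) * y.1, x.scale • y.2)

theorem continuous_preAct (x : AffSemigroup) : Continuous (preAct x) := by
  refine Continuous.prodMk (by fun_prop) ?_
  have h : Continuous fun a : SupNat => x.scale • a := by
    refine continuous_quot_lift _ ?_
    exact SupNat.continuous_mk.comp (continuous_const.mul continuous_id)
  exact h.comp continuous_snd

/-- The action `(m, k) (r, a) = (m + k r, k a)` of `ℤ ⋊ ℕˣ` on `Ω_B`. -/
instance : MulAction AffSemigroup OmegaB where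
  smul x := Quotient.map (preAct x) (by
    rintro y z ⟨h, a, ha, hd⟩
    refine ⟨congrArg (x.scale • ·) h, ((x.scale : ℕ) : ZHat) * a, ?_, ?_⟩
    · rw [← SupNat.smul_mk, ha]; rfl
    · have : (preAct x y).1 - (preAct x z).1 = ((x.scale : ℕ) : ZHat) * (y.1 - z.1) := by
        simp only [preAct]; ring
      rw [this]
      exact mul_dvd_mul_left _ hd)
  one_smul ω := by
    obtain ⟨y, rfl⟩ := proj_surjective ω
    refine congrArg proj (Prod.ext ?_ ?_)
    · simp [preAct, AffSemigroup.one_trans, AffSemigroup.one_scale]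
    · exact one_smul ℕ+ y.2
  mul_smul x x' ω := by
    obtain ⟨y, rfl⟩ := proj_surjective ω
    refine congrArg proj (Prod.ext ?_ ?_)
    · simp only [preAct, AffSemigroup.mul_trans, AffSemigroup.mul_scale]
      push_cast
      ring
    · exact mul_smul x.scale x'.scale y.2

theorem smul_proj (x : AffSemigroup) (r : ZHat) (a : SupNat) :
    x • proj (r, a) = proj ((x.trans : ZHat) + ((x.scale : ℕ) : ZHat) * r, x.scale • a) := rfl

instance : ContinuousConstSMul AffSemigroup OmegaB where
  continuous_const_smul x := continuous_quot_lift _ (continuous_proj.comp (continuous_preAct x))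

/-- The scaling condition `μ((m, n) Y) = n ^ (-β) μ(Y)` for a measure on `Ω_B`. -/
def Scaling (β : ℝ) (μ : Measure OmegaB) : Prop :=
  ∀ Y : Set OmegaB, MeasurableSet Y → ∀ x : AffSemigroup,
    μ ((fun ω => x • ω) '' Y) = ENNReal.ofReal (((x.scale : ℕ) : ℝ) ^ (-β)) * μ Y

end OmegaB

/-! ## Haar measure and the symmetric Bost–Connes measures -/

/-- The Haar probability measure on `ZHat`. -/
def haarZHat : Measure ZHat := Measure.addHaarMeasure ⊤

/-- The scaling condition `ν(n Y) = n ^ (-s) ν(Y)` for a measure on `SupNat`; the probability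
measures with this property are those defining KMS-states of the symmetric part of the Bost–Connes
system at inverse temperature `s`. -/
def SupNat.Scaling (s : ℝ) (ν : Measure SupNat) : Prop :=
  ∀ Y : Set SupNat, MeasurableSet Y → ∀ n : ℕ+,
    ν ((fun a => n • a) '' Y) = ENNReal.ofReal (((n : ℕ) : ℝ) ^ (-s)) * ν Y

/-- The measure on `ℤₚ` with mass `p ^ (-n s) (1 - p ^ (-s))` at the point `p ^ n`, `n ≥ 0`. -/
def localBostConnes (s : ℝ) (p : PrimeNumber) : Measure ℤ_[(p : ℕ)] :=
  Measure.sum fun n : ℕ =>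
    ENNReal.ofReal (((p : ℕ) : ℝ) ^ (-(n * s)) * (1 - ((p : ℕ) : ℝ) ^ (-s))) •
      Measure.dirac (((p : ℕ) : ℤ_[(p : ℕ)]) ^ n)

/-- The symmetric Bost–Connes measure at inverse temperature `s ≥ 0`: the point mass at `0` if
`s = 0`, and the product over all primes `p` of the probability measures on `ℤₚ / ℤₚˣ` with mass
`p ^ (-n s) (1 - p ^ (-s))` at the class of `p ^ n` if `s > 0`. -/
def symBostConnes (s : ℝ) : Measure SupNat :=
  if s = 0 then Measure.dirac (SupNat.mk 0)
  else (Measure.infinitePi (localBostConnes s)).map SupNat.mk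

/-! ## KMS-states -/

/-- The C⋆-algebra `C(Ω_B) ⋊ (ℤ ⋊ ℕˣ)`. -/
abbrev Alg : Type := CrossedProduct OmegaB AffSemigroup

/-- The dynamics: `σ t` is the identity on `C(Ω_B)` and multiplies the isometry `v (m, k)` by
`k ^ (i t)`. -/
def σ (t : ℝ) : Alg →⋆ₐ[ℂ] Alg := CrossedProduct.gauge (AffSemigroup.character t)

/-- `F` is an entire extension of the orbit `t ↦ σ t a`. -/
def IsEntireExtension (a : Alg) (F : ℂ → Alg) : Prop :=
  Differentiable ℂ F ∧ ∀ t : ℝ, F t = σ t a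

/-- States: positive linear functionals of norm one. -/
structure IsState (φ : Alg →ₗ[ℂ] ℂ) : Prop where
  nonneg : ∀ a, 0 ≤ (φ (star a * a)).re ∧ (φ (star a * a)).im = 0
  map_one : φ 1 = 1

/-- `σ`-KMS-states at inverse temperature `β`: the `σ`-invariant states `φ` such that
`φ (a b) = φ (b σ_{iβ}(a))` for all `σ`-analytic elements `a` and `b`, where `σ_z(a)`, `z ∈ ℂ`, is
the entire extension of `t ↦ σ_t(a)`. -/
structure IsKMSState (β : ℝ) (φ : Alg →ₗ[ℂ] ℂ) : Prop where
  isState : IsState φ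
  invariant : ∀ (t : ℝ) (a : Alg), φ (σ t a) = φ a
  kms : ∀ (a b : Alg) (F G : ℂ → Alg), IsEntireExtension a F → IsEntireExtension b G →
    φ (a * b) = φ (b * F (I * β))

/-- `φ` factors through the map `E` onto `C(Ω_B)`. -/
def FactorsThrough (E : Alg →L[ℂ] C(OmegaB, ℂ)) (φ : Alg →ₗ[ℂ] ℂ) : Prop :=
  ∃ ψ : C(OmegaB, ℂ) →ₗ[ℂ] ℂ, ∀ a, φ a = ψ (E a)

end AffineBC
end

/-!
The sets `x • Ω_B`, for `x ∈ ℤ ⋊ ℕˣ`, carry the whole argument. They are clopen, they separate the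
points of the compact space `Ω_B`, and two of them are disjoint or intersect in a third one. Hence
they form a π-system generating the Borel sets, and their indicator functions span a dense
⋆-subalgebra of `C(Ω_B)`.

*Measures.* A probability measure `μ` satisfies the scaling condition at `β` if and only if
`μ (x • Ω_B) = k ^ (-β)` for all `x = (m, k)` (`OmegaB.scaling_iff`), so there is at most one such
measure. Since the preimage of `x • Ω_B` is the product of a congruence class modulo `k`, of Haar
measure `1 / k`, and the set of multiples of `k`, of measure `k ^ (-(β - 1))` for the symmetric
Bost–Connes measure, the image of the product measure does scale
(`OmegaB.scaling_scalingMeasure`). For `β < 1` the disjoint sets `(0, 2) • Ω_B` and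
`(1, 2) • Ω_B` would have total mass `2 * 2 ^ (-β) > 1`.

*The conditional expectation.* By the Ore condition the elements `(v x)⋆ * ι f * v y` span a dense
⋆-subalgebra, which gives uniqueness. For existence the crossed product is represented on
`ℓ²(ℤ ⋊ ℕˣ)` by left translations and by the values of functions along the orbit of the point
`(0, 1)`; the diagonal matrix coefficients of an element are the values of its expectation along
this orbit, which is dense in `Ω_B` (`expectation_smul_origin`).

*KMS states.* The KMS condition for `v x` and `(v x)⋆` gives `φ (v x * (v x)⋆) = k ^ (-β)`, that is,
the scaling condition (`IsKMSState.apply_ι_shift_one`); this also excludes `β < 1`, as for measures,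
and determines a state factoring through the expectation by density of the indicator functions.
Conversely, for an eigenvector `b` of the dynamics, `σ_t b = exp (i t l) b`, invariance of `φ` and
the identity theorem give `φ (b σ_{iβ}(a)) = exp (l β) φ (b a)` for every entire `a`
(`IsEigenvector.apply_mul_entireExtension`), and so the KMS condition reduces to the relation
`φ (a b) = exp (l β) φ (b a)`. This relation is stable under products and adjoints in `b`, and for
the generators `ι f` and `v x` it is checked on monomials.
-/

noncomputable section

namespace AffineBC

/-! ### Divisibility by integers in the ring of integral adeles -/

namespace ZHat

theorem natCast_mul_cancel {n : ℕ} (hn : n ≠ 0) {a b : ZHat} (h : (n : ZHat) * a = n * b) :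
    a = b := by
  funext p
  have hp := congrFun h p
  simp only [Pi.mul_apply, Pi.natCast_apply] at hp
  exact mul_left_cancel₀ (Nat.cast_ne_zero.2 hn) hp

theorem natCast_mul_dvd_mul {n : ℕ} (hn : n ≠ 0) {a b : ZHat} :
    (n : ZHat) * a ∣ n * b ↔ a ∣ b := by
  refine ⟨?_, mul_dvd_mul_left _⟩
  rintro ⟨c, hc⟩
  exact ⟨c, natCast_mul_cancel hn (hc.trans (mul_assoc _ _ _))⟩

theorem isUnit_natCast {p : PrimeNumber} {n : ℕ} (h : ¬ (p : ℕ) ∣ n) :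
    IsUnit (n : ℤ_[(p : ℕ)]) := by
  rw [PadicInt.isUnit_iff, PadicInt.norm_natCast_eq_one_iff]
  exact (Nat.Prime.coprime_iff_not_dvd p.2).2 h

/-- Divisibility by a prime power in `∏ₚ ℤₚ` concerns a single coordinate, since the prime is
invertible in the others. -/
theorem prime_pow_dvd_iff (p : PrimeNumber) (k : ℕ) (a : ZHat) :
    (((p : ℕ) ^ k : ℕ) : ZHat) ∣ a ↔ ((p : ℕ) : ℤ_[(p : ℕ)]) ^ k ∣ a p := by
  rw [pi_dvd_iff]
  simp only [Pi.natCast_apply]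
  refine ⟨fun h => by simpa using h p, fun h q => ?_⟩
  by_cases hq : q = p
  · subst hq
    simpa using h
  · refine (isUnit_natCast fun hd => hq ?_).dvd
    exact Subtype.ext ((Nat.prime_dvd_prime_iff_eq q.2 p.2).1 (q.2.dvd_of_dvd_pow hd))

theorem natCast_dvd_intCast {n : ℕ} {d : ℤ} : (n : ZHat) ∣ (d : ZHat) ↔ (n : ℤ) ∣ d := by
  constructor
  · intro h
    rw [Int.natCast_dvd, Nat.dvd_iff_prime_pow_dvd_dvd]
    intro p k hp hk
    have h1 : ((p ^ k : ℕ) : ZHat) ∣ (d : ZHat) := (Nat.cast_dvd_cast hk).trans h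
    rw [prime_pow_dvd_iff ⟨p, hp⟩ k, Pi.intCast_apply] at h1
    have h2 := (PadicInt.pow_p_dvd_int_iff (p := p) (hp := ⟨hp⟩) k d).1 h1
    rw [← Int.natCast_dvd]
    exact_mod_cast h2
  · rintro ⟨c, rfl⟩
    exact ⟨c, by push_cast; rfl⟩

/-- Every integral adele is congruent to an integer modulo `n`. -/
theorem exists_intCast_sub_dvd {n : ℕ} (hn : n ≠ 0) :
    ∀ r : ZHat, ∃ m : ℤ, (n : ZHat) ∣ r - (m : ZHat) := by
  induction n using Nat.recOnMul with
  | zero => exact absurd rfl hn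
  | one => exact fun r => ⟨0, by simp⟩
  | prime p hp =>
    intro r
    obtain ⟨q, rfl⟩ : ∃ q : PrimeNumber, (q : ℕ) = p := ⟨⟨p, hp⟩, rfl⟩
    have h : ((q : ℕ) : ℤ_[(q : ℕ)]) ^ 1 ∣ r q - (((r q).appr 1 : ℕ) : ℤ_[(q : ℕ)]) := by
      have := PadicInt.appr_spec (p := (q : ℕ)) 1 (r q)
      exact Ideal.mem_span_singleton.1 this
    refine ⟨((r q).appr 1 : ℕ), ?_⟩
    have := (prime_pow_dvd_iff q 1 (r - (((r q).appr 1 : ℕ) : ℤ))).2 (by simpa using h)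
    simpa using this
  | mul a b iha ihb =>
    intro r
    obtain ⟨m, r', h⟩ := iha (left_ne_zero_of_mul hn) r
    obtain ⟨m', r'', h'⟩ := ihb (right_ne_zero_of_mul hn) r'
    refine ⟨m + a * m', r'', ?_⟩
    push_cast
    rw [← sub_sub, h, ← mul_sub, h', mul_assoc]

theorem exists_pnat_sub_dvd (n : ℕ+) (r : ZHat) :
    ∃ m : ℕ+, ((n : ℕ) : ZHat) ∣ r - ((m : ℕ) : ZHat) := by
  obtain ⟨m, hm⟩ := exists_intCast_sub_dvd n.ne_zero r
  -- Adding a multiple of `n` makes the representative positive.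
  have hpos : 0 < m + n * (|m| + 1) := by
    have h1 : (1 : ℤ) ≤ n := by exact_mod_cast n.pos
    have h2 := neg_abs_le m
    have h3 := abs_nonneg m
    nlinarith
  refine ⟨⟨(m + n * (|m| + 1)).toNat, by omega⟩, ?_⟩
  have hc : (((m + n * (|m| + 1)).toNat : ℕ) : ZHat) = ((m + n * (|m| + 1) : ℤ) : ZHat) := by
    rw [← Int.cast_natCast, Int.toNat_of_nonneg hpos.le]
  rw [PNat.mk_coe, hc]
  push_cast
  rw [← sub_sub]
  exact dvd_sub hm (dvd_mul_right _ _)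

theorem exists_lt_sub_dvd (n : ℕ+) (r : ZHat) :
    ∃ m < (n : ℕ), ((n : ℕ) : ZHat) ∣ r - (m : ZHat) := by
  obtain ⟨m, hm⟩ := exists_pnat_sub_dvd n r
  refine ⟨m % n, Nat.mod_lt _ n.pos, ?_⟩
  have h1 : ((n : ℕ) : ZHat) ∣ ((m : ℕ) : ZHat) - ((m % n : ℕ) : ZHat) := by
    refine ⟨((m / n : ℕ) : ZHat), ?_⟩
    rw [sub_eq_iff_eq_add]
    exact_mod_cast congrArg (Nat.cast : ℕ → ZHat) (Nat.div_add_mod (m : ℕ) n).symm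
  have := dvd_add hm h1
  rwa [sub_add_sub_cancel] at this

theorem lcm_dvd_iff (m n : ℕ+) (a : ZHat) :
    ((PNat.lcm m n : ℕ) : ZHat) ∣ a ↔ ((m : ℕ) : ZHat) ∣ a ∧ ((n : ℕ) : ZHat) ∣ a := by
  rw [PNat.lcm_coe]
  constructor
  · exact fun h => ⟨(Nat.cast_dvd_cast (Nat.dvd_lcm_left _ _)).trans h,
      (Nat.cast_dvd_cast (Nat.dvd_lcm_right _ _)).trans h⟩
  · rintro ⟨⟨b, hb⟩, ⟨c, hc⟩⟩
    have hg : Nat.gcd m n ≠ 0 := (Nat.gcd_pos_of_pos_left _ m.pos).ne'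
    -- Multiply by the greatest common divisor and use Bézout's identity.
    rw [← natCast_mul_dvd_mul hg]
    have h1 : ((Nat.gcd m n : ℕ) : ZHat)
        = ((m : ℕ) : ZHat) * (Nat.gcdA m n : ZHat) + ((n : ℕ) : ZHat) * (Nat.gcdB m n : ZHat) := by
      have := congrArg (Int.cast : ℤ → ZHat) (Nat.gcd_eq_gcd_ab m n)
      push_cast at this
      exact this
    have h2 : ((Nat.gcd m n : ℕ) : ZHat) * ((Nat.lcm m n : ℕ) : ZHat)
        = ((m : ℕ) : ZHat) * ((n : ℕ) : ZHat) := by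
      exact_mod_cast congrArg (Nat.cast : ℕ → ZHat) (Nat.gcd_mul_lcm m n)
    rw [h2]
    refine ⟨(Nat.gcdA m n : ZHat) * c + (Nat.gcdB m n : ZHat) * b, ?_⟩
    rw [h1, add_mul]
    nth_rewrite 1 [hc]
    rw [hb]
    ring

/-- Divisibility in `∏ₚ ℤₚ` is detected by positive integers. -/
theorem dvd_of_forall_natCast_dvd {a b : ZHat}
    (h : ∀ n : ℕ+, ((n : ℕ) : ZHat) ∣ a → ((n : ℕ) : ZHat) ∣ b) : a ∣ b := by
  have hpow : ∀ (p : PrimeNumber) (k : ℕ), ((p : ℕ) : ℤ_[(p : ℕ)]) ^ k ∣ a p →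
      ((p : ℕ) : ℤ_[(p : ℕ)]) ^ k ∣ b p := fun p k hk =>
    (prime_pow_dvd_iff p k b).1 (h ⟨(p : ℕ) ^ k, pow_pos p.2.pos k⟩
      ((prime_pow_dvd_iff p k a).2 hk))
  rw [pi_dvd_iff]
  intro p
  by_cases ha : a p = 0
  · have hb : b p = 0 := by
      by_contra hb
      have h1 := hpow p ((b p).valuation + 1) (by rw [ha]; exact dvd_zero _)
      rw [← Ideal.mem_span_singleton, PadicInt.mem_span_pow_iff_le_valuation _ hb] at h1
      omega
    rw [ha, hb]
  · have h1 := PadicInt.unitCoeff_spec ha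
    have h2 : a p ∣ ((p : ℕ) : ℤ_[(p : ℕ)]) ^ (a p).valuation := by
      conv_lhs => rw [h1]
      exact (Units.mul_left_dvd).2 dvd_rfl
    refine h2.trans (hpow p _ ?_)
    conv_rhs => rw [h1]
    exact dvd_mul_left _ _

theorem eq_zero_of_forall_natCast_dvd {a : ZHat} (h : ∀ n : ℕ+, ((n : ℕ) : ZHat) ∣ a) : a = 0 :=
  zero_dvd_iff.1 (dvd_of_forall_natCast_dvd fun n _ => h n)

/-- The closed ideal of multiples of `n` in the ring of integral adeles. -/
def multiples (n : ℕ+) : AddSubgroup ZHat := (AddMonoidHom.mulLeft ((n : ℕ) : ZHat)).range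

theorem mem_multiples {n : ℕ+} {a : ZHat} : a ∈ multiples n ↔ ((n : ℕ) : ZHat) ∣ a :=
  ⟨fun ⟨b, hb⟩ => ⟨b, hb.symm⟩, fun ⟨b, hb⟩ => ⟨b, hb.symm⟩⟩

theorem isClosed_multiples (n : ℕ+) : IsClosed (multiples n : Set ZHat) := by
  have : (multiples n : Set ZHat) = Set.range fun a : ZHat => ((n : ℕ) : ZHat) * a := rfl
  rw [this]
  exact (isCompact_range (by fun_prop)).isClosed

instance (n : ℕ+) : (multiples n).FiniteIndex := by
  -- The residues `0, …, n - 1` represent all cosets.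
  have hsurj : Function.Surjective
      fun k : Fin n => (QuotientAddGroup.mk ((k : ℕ) : ZHat) : ZHat ⧸ multiples n) := by
    intro q
    obtain ⟨r, rfl⟩ := QuotientAddGroup.mk_surjective q
    obtain ⟨m, hlt, hm⟩ := exists_lt_sub_dvd n r
    exact ⟨⟨m, hlt⟩, by rwa [QuotientAddGroup.eq, mem_multiples, neg_add_eq_sub]⟩
  have := Finite.of_surjective _ hsurj
  exact AddSubgroup.finiteIndex_of_finite_quotient

theorem isClopen_multiples (n : ℕ+) : IsClopen (multiples n : Set ZHat) :=
  ⟨isClosed_multiples n,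
    AddSubgroup.isOpen_of_isClosed_of_finiteIndex _ (isClosed_multiples n)⟩

/-- The congruence class of `r` modulo `n`. -/
def residueClass (r : ZHat) (n : ℕ+) : Set ZHat := {x | ((n : ℕ) : ZHat) ∣ x - r}

theorem isClopen_residueClass (r : ZHat) (n : ℕ+) : IsClopen (residueClass r n) := by
  have : residueClass r n = (fun x => x - r) ⁻¹' (multiples n : Set ZHat) :=
    Set.ext fun x => (mem_multiples (n := n) (a := x - r)).symm
  rw [this]
  exact (isClopen_multiples n).preimage (by fun_prop)

/-- The congruence classes of `r` form a basis of neighbourhoods. -/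
theorem exists_residueClass_subset {r : ZHat} {U : Set ZHat} (hU : IsOpen U) (hr : r ∈ U) :
    ∃ n, residueClass r n ⊆ U := by
  refine exists_subset_nhds_of_compactSpace (V := residueClass r) ?_
    (fun n => (isClopen_residueClass r n).isClosed) ?_
  · intro m n
    exact ⟨PNat.lcm m n, fun x hx => ((lcm_dvd_iff m n _).1 hx).1,
      fun x hx => ((lcm_dvd_iff m n _).1 hx).2⟩
  · intro x hx
    have : x = r := sub_eq_zero.1 (eq_zero_of_forall_natCast_dvd fun n => Set.mem_iInter.1 hx n)
    exact this ▸ hU.mem_nhds hr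

theorem denseRange_pnat : DenseRange fun n : ℕ+ => ((n : ℕ) : ZHat) := by
  intro r
  rw [mem_closure_iff]
  intro U hU hr
  obtain ⟨n, hn⟩ := exists_residueClass_subset hU hr
  obtain ⟨m, hm⟩ := exists_pnat_sub_dvd n r
  refine ⟨_, hn ?_, m, rfl⟩
  rw [residueClass, Set.mem_ofPred_eq, ← neg_sub]
  exact hm.neg_right

theorem denseRange_int : DenseRange fun m : ℤ => (m : ZHat) :=
  denseRange_pnat.mono (by rintro _ ⟨n, rfl⟩; exact ⟨n, by simp⟩)

end ZHat

/-! ### Compact spaces with a countable separating family of clopen sets -/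

section Separating

variable {X ι : Type*} [TopologicalSpace X] {U : ι → Set X}

open Classical in
theorem isClosedEmbedding_of_separating [CompactSpace X] (hU : ∀ i, IsClopen (U i))
    (hsep : ∀ x y, (∀ i, x ∈ U i ↔ y ∈ U i) → x = y) :
    Topology.IsClosedEmbedding fun (x : X) (i : ι) => decide (x ∈ U i) := by
  refine Continuous.isClosedEmbedding ?_ fun x y h => hsep x y fun i => ?_
  · refine continuous_pi fun i => ?_
    exact (continuous_boolIndicator_iff_isClopen (U i)).2 (hU i)
  · simpa using congrFun h i

theorem t2Space_of_separating [CompactSpace X] (hU : ∀ i, IsClopen (U i))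
    (hsep : ∀ x y, (∀ i, x ∈ U i ↔ y ∈ U i) → x = y) : T2Space X :=
  (isClosedEmbedding_of_separating hU hsep).isEmbedding.t2Space

/-- The Borel sets of a compact space are generated by every countable family of clopen sets which
separates the points. -/
theorem borel_eq_generateFrom_of_separating [CompactSpace X] [Countable ι]
    (hU : ∀ i, IsClopen (U i)) (hsep : ∀ x y, (∀ i, x ∈ U i ↔ y ∈ U i) → x = y) :
    borel X = MeasurableSpace.generateFrom (Set.range U) := by
  classical
  refine le_antisymm ?_ (MeasurableSpace.generateFrom_le ?_)
  · rw [(isClosedEmbedding_of_separating hU hsep).isInducing.eq_induced, borel_comap]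
    rw [← @BorelSpace.measurable_eq (ι → Bool) _ _ _]
    refine (@measurable_iff_comap_le _ _ (MeasurableSpace.generateFrom (Set.range U)) _ _).1 ?_
    refine @measurable_pi_lambda _ _ _ (MeasurableSpace.generateFrom (Set.range U)) _ _ fun i => ?_
    refine @measurable_to_bool _ (MeasurableSpace.generateFrom (Set.range U)) _ ?_
    have : (fun x => decide (x ∈ U i)) ⁻¹' {true} = U i := by ext; simp
    rw [this]
    exact MeasurableSpace.measurableSet_generateFrom ⟨i, rfl⟩
  · rintro _ ⟨i, rfl⟩
    exact MeasurableSpace.measurableSet_generateFrom (hU i).isOpen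

end Separating

/-! ### The sets `n • SupNat` and `x • Ω_B` -/

namespace SupNat

theorem mk_mem_range_smul {n : ℕ+} {a : ZHat} :
    mk a ∈ Set.range (fun b : SupNat => n • b) ↔ ((n : ℕ) : ZHat) ∣ a := by
  constructor
  · rintro ⟨b, hb⟩
    obtain ⟨b, rfl⟩ := mk_surjective b
    exact (dvd_mul_right _ _).trans (dvd_of_mk_eq hb)
  · rintro ⟨b, rfl⟩
    exact ⟨mk b, rfl⟩

theorem smul_injective (n : ℕ+) : Function.Injective fun a : SupNat => n • a := by
  intro a b h
  obtain ⟨a, rfl⟩ := mk_surjective a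
  obtain ⟨b, rfl⟩ := mk_surjective b
  obtain ⟨u, hu⟩ := mk_eq_mk.1 h
  refine mk_eq_mk.2 ⟨u, ZHat.natCast_mul_cancel n.ne_zero ?_⟩
  exact (mul_left_comm _ _ _).trans hu

theorem isClopen_range_smul (n : ℕ+) : IsClopen (Set.range fun a : SupNat => n • a) := by
  have hq : Topology.IsQuotientMap mk := isQuotientMap_quot_mk
  rw [← hq.isClopen_preimage]
  convert ZHat.isClopen_multiples n using 1
  ext a
  exact mk_mem_range_smul.trans ZHat.mem_multiples.symm

theorem mk_eq_mk_of_dvd {a b : ZHat} (hab : a ∣ b) (hba : b ∣ a) : mk a = mk b := by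
  have h : ∀ p : PrimeNumber, ∃ u : ℤ_[(p : ℕ)]ˣ, b p * u = a p := fun p =>
    associated_of_dvd_dvd (pi_dvd_iff.1 hba p) (pi_dvd_iff.1 hab p)
  choose u hu using h
  refine mk_eq_mk.2 ⟨MulEquiv.piUnits.symm u, ?_⟩
  funext p
  rw [← hu p, mul_comm]
  rfl

theorem eq_of_forall_mem_range_smul {a b : SupNat} (h : ∀ n : ℕ+,
    a ∈ Set.range (fun c : SupNat => n • c) ↔ b ∈ Set.range (fun c : SupNat => n • c)) :
    a = b := by
  obtain ⟨a, rfl⟩ := mk_surjective a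
  obtain ⟨b, rfl⟩ := mk_surjective b
  simp only [mk_mem_range_smul] at h
  exact mk_eq_mk_of_dvd (ZHat.dvd_of_forall_natCast_dvd fun n => (h n).1)
    (ZHat.dvd_of_forall_natCast_dvd fun n => (h n).2)

instance : T2Space SupNat :=
  t2Space_of_separating isClopen_range_smul fun _ _ => eq_of_forall_mem_range_smul

theorem measurableSpace_eq : (inferInstance : MeasurableSpace SupNat) =
    MeasurableSpace.generateFrom (Set.range fun n : ℕ+ => Set.range fun a : SupNat => n • a) :=
  borel_eq_generateFrom_of_separating isClopen_range_smul fun _ _ => eq_of_forall_mem_range_smul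

theorem range_smul_inter (m n : ℕ+) :
    (Set.range fun a : SupNat => m • a) ∩ (Set.range fun a : SupNat => n • a) =
      Set.range fun a : SupNat => PNat.lcm m n • a := by
  ext a
  obtain ⟨a, rfl⟩ := mk_surjective a
  rw [Set.mem_inter_iff, mk_mem_range_smul, mk_mem_range_smul, mk_mem_range_smul,
    ZHat.lcm_dvd_iff]

theorem isPiSystem_range_smul :
    IsPiSystem (Set.range fun n : ℕ+ => Set.range fun a : SupNat => n • a) := by
  rintro _ ⟨m, rfl⟩ _ ⟨n, rfl⟩ -
  exact ⟨PNat.lcm m n, (range_smul_inter m n).symm⟩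

theorem continuous_smul (n : ℕ+) : Continuous fun a : SupNat => n • a :=
  continuous_quot_lift _ (continuous_mk.comp (by fun_prop))

end SupNat

namespace AffSemigroup

theorem eq_of_mul_eq_mul_left {x y z : AffSemigroup} (h : x * y = x * z) : y = z := by
  have h1 := congrArg trans h
  have h2 := congrArg scale h
  rw [mul_trans, mul_trans, add_right_inj] at h1
  refine AffSemigroup.ext ?_ (mul_left_cancel h2)
  exact mul_left_cancel₀ (by exact_mod_cast x.scale.ne_zero) h1

theorem eq_of_mul_eq_mul_right {x y z : AffSemigroup} (h : x * z = y * z) : x = y := by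
  have h1 := congrArg trans h
  have h2 : x.scale = y.scale := mul_right_cancel (congrArg scale h)
  rw [mul_trans, mul_trans, h2, add_left_inj] at h1
  exact AffSemigroup.ext h1 h2

instance : IsCancelMul AffSemigroup where
  mul_left_cancel _ _ _ h := eq_of_mul_eq_mul_left h
  mul_right_cancel _ _ _ h := eq_of_mul_eq_mul_right h

/-- The Ore condition: two elements always have a common left multiple. -/
theorem exists_mul_eq_mul (x y : AffSemigroup) :
    ∃ z w : AffSemigroup, z * x = w * y := by
  refine ⟨⟨x.scale * y.trans, y.scale⟩, ⟨y.scale * x.trans, x.scale⟩, ?_⟩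
  refine AffSemigroup.ext ?_ (mul_comm _ _)
  rw [mul_trans, mul_trans]
  exact add_comm _ _

instance : Countable AffSemigroup :=
  Function.Injective.countable (f := fun x : AffSemigroup => (x.trans, x.scale)) fun _ _ h =>
    AffSemigroup.ext (congrArg Prod.fst h) (congrArg Prod.snd h)

end AffSemigroup

namespace OmegaB

theorem proj_eq_proj {r r' : ZHat} {a a' : ZHat} :
    proj (r, SupNat.mk a) = proj (r', SupNat.mk a') ↔ SupNat.mk a = SupNat.mk a' ∧ a ∣ r - r' := by
  refine Quotient.eq.trans ⟨?_, fun ⟨h, hd⟩ => ⟨h, a, rfl, hd⟩⟩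
  rintro ⟨h, b, hb, hd⟩
  exact ⟨h, (SupNat.dvd_of_mk_eq hb.symm).trans hd⟩

/-- The set of all `x • ω`; it consists of the classes `(r, a)` such that the scale of `x` divides
`a` and `r` is congruent to the translation part of `x` modulo that scale. -/
abbrev cyl (x : AffSemigroup) : Set OmegaB := Set.range fun ω : OmegaB => x • ω

theorem proj_mem_cyl {x : AffSemigroup} {r a : ZHat} :
    proj (r, SupNat.mk a) ∈ cyl x ↔
      ((x.scale : ℕ) : ZHat) ∣ r - (x.trans : ZHat) ∧ ((x.scale : ℕ) : ZHat) ∣ a := by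
  constructor
  · rintro ⟨ω, hω⟩
    obtain ⟨⟨r', a'⟩, rfl⟩ := proj_surjective ω
    obtain ⟨a', rfl⟩ := SupNat.mk_surjective a'
    change x • proj _ = _ at hω
    rw [smul_proj, SupNat.smul_mk] at hω
    obtain ⟨h1, h2⟩ := proj_eq_proj.1 hω.symm
    have h3 := (dvd_mul_right _ a').trans (SupNat.dvd_of_mk_eq h1.symm)
    refine ⟨?_, h3⟩
    have h4 := dvd_add (h3.trans h2) (dvd_mul_right ((x.scale : ℕ) : ZHat) r')
    rwa [← sub_sub, sub_add_cancel] at h4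
  · rintro ⟨⟨r', hr⟩, ⟨a', rfl⟩⟩
    refine ⟨proj (r', SupNat.mk a'), ?_⟩
    change x • proj (r', SupNat.mk a') = _
    rw [smul_proj, SupNat.smul_mk, ← hr, add_sub_cancel]

theorem smul_injective (x : AffSemigroup) : Function.Injective fun ω : OmegaB => x • ω := by
  intro ω ω' h
  obtain ⟨⟨r, a⟩, rfl⟩ := proj_surjective ω
  obtain ⟨⟨r', a'⟩, rfl⟩ := proj_surjective ω'
  obtain ⟨a, rfl⟩ := SupNat.mk_surjective a
  obtain ⟨a', rfl⟩ := SupNat.mk_surjective a'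
  change x • proj _ = x • proj _ at h
  rw [smul_proj, smul_proj, SupNat.smul_mk, SupNat.smul_mk] at h
  obtain ⟨h1, h2⟩ := proj_eq_proj.1 h
  refine proj_eq_proj.2 ⟨SupNat.smul_injective x.scale h1, ?_⟩
  rwa [add_sub_add_left_eq_sub, ← mul_sub, ZHat.natCast_mul_dvd_mul x.scale.ne_zero] at h2

theorem preimage_proj_cyl (x : AffSemigroup) :
    proj ⁻¹' cyl x = ZHat.residueClass x.trans x.scale ×ˢ
      Set.range fun a : SupNat => x.scale • a := by
  ext ⟨r, a⟩
  obtain ⟨a, rfl⟩ := SupNat.mk_surjective a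
  rw [Set.mem_preimage, proj_mem_cyl, Set.mem_prod, SupNat.mk_mem_range_smul]
  rfl

theorem isClopen_cyl (x : AffSemigroup) : IsClopen (cyl x) := by
  have hq : Topology.IsQuotientMap proj := isQuotientMap_quot_mk
  rw [← hq.isClopen_preimage, preimage_proj_cyl]
  exact (ZHat.isClopen_residueClass _ _).prod (SupNat.isClopen_range_smul _)

theorem eq_of_forall_mem_cyl {ω ω' : OmegaB} (h : ∀ x, ω ∈ cyl x ↔ ω' ∈ cyl x) : ω = ω' := by
  obtain ⟨⟨r, a⟩, rfl⟩ := proj_surjective ω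
  obtain ⟨⟨r', a'⟩, rfl⟩ := proj_surjective ω'
  obtain ⟨a, rfl⟩ := SupNat.mk_surjective a
  obtain ⟨a', rfl⟩ := SupNat.mk_surjective a'
  simp only [proj_mem_cyl] at h
  have key : ∀ (n : ℕ+), ∃ m : ℤ, ((n : ℕ) : ZHat) ∣ r - (m : ZHat) := fun n =>
    ZHat.exists_intCast_sub_dvd n.ne_zero r
  have key' : ∀ (n : ℕ+), ∃ m : ℤ, ((n : ℕ) : ZHat) ∣ r' - (m : ZHat) := fun n =>
    ZHat.exists_intCast_sub_dvd n.ne_zero r'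
  refine proj_eq_proj.2 ⟨SupNat.mk_eq_mk_of_dvd ?_ ?_, ?_⟩
  · refine ZHat.dvd_of_forall_natCast_dvd fun n hn => ?_
    obtain ⟨m, hm⟩ := key n
    exact ((h ⟨m, n⟩).1 ⟨hm, hn⟩).2
  · refine ZHat.dvd_of_forall_natCast_dvd fun n hn => ?_
    obtain ⟨m, hm⟩ := key' n
    exact ((h ⟨m, n⟩).2 ⟨hm, hn⟩).2
  · refine ZHat.dvd_of_forall_natCast_dvd fun n hn => ?_
    obtain ⟨m, hm⟩ := key n
    have := dvd_sub hm ((h ⟨m, n⟩).1 ⟨hm, hn⟩).1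
    rwa [sub_sub_sub_cancel_right] at this

instance : T2Space OmegaB :=
  t2Space_of_separating isClopen_cyl fun _ _ => eq_of_forall_mem_cyl

theorem measurableSpace_eq : (inferInstance : MeasurableSpace OmegaB) =
    MeasurableSpace.generateFrom (Set.range cyl) :=
  borel_eq_generateFrom_of_separating isClopen_cyl fun _ _ => eq_of_forall_mem_cyl

/-- Two intersecting images of the semigroup elements intersect in a third one. -/
theorem cyl_inter {x y : AffSemigroup} (h : (cyl x ∩ cyl y).Nonempty) :
    ∃ z, cyl z = cyl x ∩ cyl y := by
  obtain ⟨ω, hx, hy⟩ := h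
  obtain ⟨⟨r, a⟩, rfl⟩ := proj_surjective ω
  obtain ⟨a, rfl⟩ := SupNat.mk_surjective a
  rw [proj_mem_cyl] at hx hy
  obtain ⟨m, hm⟩ := ZHat.exists_intCast_sub_dvd (PNat.lcm x.scale y.scale).ne_zero r
  obtain ⟨hmx, hmy⟩ := (ZHat.lcm_dvd_iff _ _ _).1 hm
  refine ⟨⟨m, PNat.lcm x.scale y.scale⟩, Set.ext fun ω' => ?_⟩
  obtain ⟨⟨r', a'⟩, rfl⟩ := proj_surjective ω'
  obtain ⟨a', rfl⟩ := SupNat.mk_surjective a'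
  have hc : ∀ {n : ℕ+} {t : ℤ}, ((n : ℕ) : ZHat) ∣ r - (t : ZHat) →
      ((n : ℕ) : ZHat) ∣ r - (m : ZHat) →
      (((n : ℕ) : ZHat) ∣ r' - (m : ZHat) ↔ ((n : ℕ) : ZHat) ∣ r' - (t : ZHat)) := by
    intro n t h1 h2
    have h3 := dvd_sub h1 h2
    rw [sub_sub_sub_cancel_left] at h3
    have h4 : r' - (t : ZHat) = (r' - m) + (m - t) := by ring
    rw [h4, dvd_add_left h3]
  rw [Set.mem_inter_iff, proj_mem_cyl, proj_mem_cyl, proj_mem_cyl, ZHat.lcm_dvd_iff,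
    ZHat.lcm_dvd_iff, hc hx.1 hmx, hc hy.1 hmy]
  tauto

theorem isPiSystem_cyl : IsPiSystem (Set.range cyl) := by
  rintro _ ⟨x, rfl⟩ _ ⟨y, rfl⟩ h
  exact cyl_inter h

theorem image_cyl (x y : AffSemigroup) : (fun ω : OmegaB => x • ω) '' cyl y = cyl (x * y) := by
  rw [cyl, ← Set.range_comp]
  exact congrArg Set.range (funext fun ω => smul_smul x y ω)

theorem isOpenEmbedding_smul (x : AffSemigroup) :
    Topology.IsOpenEmbedding fun ω : OmegaB => x • ω :=
  ⟨((continuous_const_smul x).isClosedEmbedding (smul_injective x)).isEmbedding,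
    (isClopen_cyl x).isOpen⟩

/-- The point `(0, 1)` of `Ω_B`. -/
def origin : OmegaB := proj (0, SupNat.mk 1)

theorem smul_origin (x : AffSemigroup) :
    x • origin = proj ((x.trans : ZHat), SupNat.mk ((x.scale : ℕ) : ZHat)) := by
  rw [origin, smul_proj, SupNat.smul_mk, mul_zero, add_zero, mul_one]

/-- The position of a point of the orbit of `origin` reflects divisibility in the semigroup. -/
theorem smul_origin_mem_cyl {x y : AffSemigroup} : y • origin ∈ cyl x ↔ ∃ z, y = x * z := by
  constructor
  · rw [smul_origin, proj_mem_cyl]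
    rintro ⟨h1, h2⟩
    have h3 : ((x.scale : ℕ) : ZHat) ∣ ((y.trans - x.trans : ℤ) : ZHat) := by
      push_cast; exact h1
    obtain ⟨m, hm⟩ := ZHat.natCast_dvd_intCast.1 h3
    have h4 : ((x.scale : ℕ) : ZHat) ∣ (((y.scale : ℕ) : ℤ) : ZHat) := by
      rwa [Int.cast_natCast]
    have h5 : x.scale ∣ y.scale :=
      PNat.dvd_iff.2 (Int.natCast_dvd_natCast.1 (ZHat.natCast_dvd_intCast.1 h4))
    obtain ⟨k, hk⟩ := h5
    refine ⟨⟨m, k⟩, AffSemigroup.ext ?_ hk⟩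
    rw [AffSemigroup.mul_trans, ← hm, add_sub_cancel]
  · rintro ⟨z, rfl⟩
    exact ⟨z • origin, smul_smul x z origin⟩

theorem denseRange_smul_origin : DenseRange fun x : AffSemigroup => x • origin := by
  have h1 : DenseRange fun k : ℕ+ => SupNat.mk ((k : ℕ) : ZHat) :=
    SupNat.mk_surjective.denseRange.comp ZHat.denseRange_pnat SupNat.continuous_mk
  have h2 := proj_surjective.denseRange.comp (ZHat.denseRange_int.prodMap h1) continuous_proj
  refine h2.mono ?_
  rintro _ ⟨⟨m, k⟩, rfl⟩
  exact ⟨⟨m, k⟩, smul_origin _⟩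

end OmegaB

/-! ### Scaling measures are determined on the images of the semigroup elements -/

namespace SupNat

theorem measurableEmbedding_smul (n : ℕ+) : MeasurableEmbedding fun a : SupNat => n • a :=
  ((continuous_smul n).isClosedEmbedding (smul_injective n)).measurableEmbedding

theorem measure_ext {μ ν : Measure SupNat} [IsFiniteMeasure μ]
    (h : ∀ n : ℕ+, μ (Set.range fun a : SupNat => n • a) = ν (Set.range fun a : SupNat => n • a)) :
    μ = ν := by
  refine ext_of_generate_finite _ measurableSpace_eq isPiSystem_range_smul ?_ ?_
  · rintro _ ⟨n, rfl⟩
    exact h n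
  · have h1 : (Set.range fun a : SupNat => (1 : ℕ+) • a) = Set.univ := by simp
    rw [← h1]
    exact h 1

theorem scaling_iff {s : ℝ} {ν : Measure SupNat} [IsProbabilityMeasure ν] :
    Scaling s ν ↔ ∀ n : ℕ+, ν (Set.range fun a : SupNat => n • a) =
      ENNReal.ofReal (((n : ℕ) : ℝ) ^ (-s)) := by
  refine ⟨fun h n => ?_, fun h Y _ n => ?_⟩
  · rw [← Set.image_univ, h _ .univ, measure_univ, mul_one]
  · rw [← (measurableEmbedding_smul n).comap_apply]
    have : IsFiniteMeasure (ν.comap fun a : SupNat => n • a) :=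
      ⟨by rw [(measurableEmbedding_smul n).comap_apply]; exact measure_lt_top _ _⟩
    have key : ν.comap (fun a : SupNat => n • a) =
        ENNReal.ofReal (((n : ℕ) : ℝ) ^ (-s)) • ν := by
      refine measure_ext fun m => ?_
      have h1 : (fun a : SupNat => n • a) '' (Set.range fun a : SupNat => m • a) =
          Set.range fun a : SupNat => (n * m) • a := by
        rw [← Set.range_comp]
        exact congrArg Set.range (funext fun a => smul_smul n m a)
      rw [(measurableEmbedding_smul n).comap_apply, h1, h, Measure.smul_apply, h, smul_eq_mul,
        ← ENNReal.ofReal_mul (by positivity), PNat.mul_coe, Nat.cast_mul,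
        Real.mul_rpow (by positivity) (by positivity)]
    rw [key, Measure.smul_apply, smul_eq_mul]

theorem scaling_unique {s : ℝ} {μ ν : Measure SupNat} [IsProbabilityMeasure μ]
    [IsProbabilityMeasure ν] (hμ : Scaling s μ) (hν : Scaling s ν) : μ = ν :=
  measure_ext fun n => (scaling_iff.1 hμ n).trans (scaling_iff.1 hν n).symm

end SupNat

namespace OmegaB

theorem measurableEmbedding_smul (x : AffSemigroup) :
    MeasurableEmbedding fun ω : OmegaB => x • ω :=
  ((continuous_const_smul x).isClosedEmbedding (smul_injective x)).measurableEmbedding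

theorem cyl_one : cyl 1 = Set.univ := by simp [cyl]

theorem measure_ext {μ ν : Measure OmegaB} [IsFiniteMeasure μ] (h : ∀ x, μ (cyl x) = ν (cyl x)) :
    μ = ν := by
  refine ext_of_generate_finite _ measurableSpace_eq isPiSystem_cyl ?_ ?_
  · rintro _ ⟨x, rfl⟩
    exact h x
  · rw [← cyl_one]
    exact h 1

theorem scaling_iff {β : ℝ} {μ : Measure OmegaB} [IsProbabilityMeasure μ] :
    Scaling β μ ↔ ∀ x, μ (cyl x) = ENNReal.ofReal (((x.scale : ℕ) : ℝ) ^ (-β)) := by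
  refine ⟨fun h x => ?_, fun h Y _ x => ?_⟩
  · rw [cyl, ← Set.image_univ, h _ .univ, measure_univ, mul_one]
  · rw [← (measurableEmbedding_smul x).comap_apply]
    have : IsFiniteMeasure (μ.comap fun ω : OmegaB => x • ω) :=
      ⟨by rw [(measurableEmbedding_smul x).comap_apply]; exact measure_lt_top _ _⟩
    have key : μ.comap (fun ω : OmegaB => x • ω) =
        ENNReal.ofReal (((x.scale : ℕ) : ℝ) ^ (-β)) • μ := by
      refine measure_ext fun y => ?_
      rw [(measurableEmbedding_smul x).comap_apply, image_cyl, h, Measure.smul_apply, h,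
        smul_eq_mul, ← ENNReal.ofReal_mul (by positivity), AffSemigroup.mul_scale, PNat.mul_coe,
        Nat.cast_mul, Real.mul_rpow (by positivity) (by positivity)]
    rw [key, Measure.smul_apply, smul_eq_mul]

theorem scaling_unique {β : ℝ} {μ ν : Measure OmegaB} [IsProbabilityMeasure μ]
    [IsProbabilityMeasure ν] (hμ : Scaling β μ) (hν : Scaling β ν) : μ = ν :=
  measure_ext fun x => (scaling_iff.1 hμ x).trans (scaling_iff.1 hν x).symm

/-- For a scaling measure the integral over `x • Ω_B` is a multiple of the integral along the orbit
map. -/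
theorem setIntegral_cyl {β : ℝ} {μ : Measure OmegaB} (h : Scaling β μ) (x : AffSemigroup)
    (f : OmegaB → ℂ) :
    ∫ ω in cyl x, f ω ∂μ = (((x.scale : ℕ) : ℝ) ^ (-β) : ℝ) * ∫ ω, f (x • ω) ∂μ := by
  have key : μ.restrict (cyl x) =
      ENNReal.ofReal (((x.scale : ℕ) : ℝ) ^ (-β)) • μ.map fun ω : OmegaB => x • ω := by
    refine Measure.ext fun Y hY => ?_
    have hpre := (measurableEmbedding_smul x).measurable hY
    rw [Measure.restrict_apply hY, Measure.smul_apply, (measurableEmbedding_smul x).map_apply,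
      smul_eq_mul, ← h _ hpre x, Set.image_preimage_eq_inter_range]
  rw [key, integral_smul_measure, (measurableEmbedding_smul x).integral_map,
    ENNReal.toReal_ofReal (by positivity), Complex.real_smul]

/-- The sets `(0, 2) • Ω_B` and `(1, 2) • Ω_B` are disjoint, because they consist of classes with
even and with odd first coordinate. -/
theorem disjoint_cyl_two : Disjoint (cyl ⟨0, 2⟩) (cyl ⟨1, 2⟩) := by
  rw [Set.disjoint_left]
  intro ω h0 h1
  obtain ⟨⟨r, a⟩, rfl⟩ := proj_surjective ω
  obtain ⟨a, rfl⟩ := SupNat.mk_surjective a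
  have h := dvd_sub (proj_mem_cyl.1 h0).1 (proj_mem_cyl.1 h1).1
  rw [sub_sub_sub_cancel_left, ← Int.cast_sub, ZHat.natCast_dvd_intCast] at h
  norm_num at h

theorem one_lt_two_mul_two_rpow {β : ℝ} (hβ : β < 1) : 1 < 2 * (2 : ℝ) ^ (-β) := by
  have h : (2 : ℝ) * 2 ^ (-β) = 2 ^ (1 - β) := by
    rw [sub_eq_add_neg, Real.rpow_add (by norm_num), Real.rpow_one]
  rw [h]
  exact Real.one_lt_rpow (by norm_num) (by linarith)

theorem not_scaling_of_lt_one {β : ℝ} (hβ : β < 1) (μ : Measure OmegaB) [IsProbabilityMeasure μ] :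
    ¬ Scaling β μ := by
  intro h
  have h1 : μ (cyl ⟨0, 2⟩) + μ (cyl ⟨1, 2⟩) ≤ 1 := by
    rw [← measure_union disjoint_cyl_two (isClopen_cyl _).isOpen.measurableSet]
    exact prob_le_one
  rw [scaling_iff.1 h, scaling_iff.1 h, ← ENNReal.ofReal_add (by positivity) (by positivity),
    ENNReal.ofReal_le_one] at h1
  have h2 := one_lt_two_mul_two_rpow hβ
  norm_num at h1
  linarith

end OmegaB

/-! ### The Haar measure of congruence classes -/

instance : IsProbabilityMeasure haarZHat :=
  ⟨(Measure.addHaarMeasure_self : haarZHat ((⊤ : TopologicalSpace.PositiveCompacts ZHat) : Set ZHat)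
    = 1)⟩

instance : haarZHat.IsAddLeftInvariant :=
  inferInstanceAs (Measure.addHaarMeasure ⊤).IsAddLeftInvariant

theorem haarZHat_residueClass (r : ZHat) (n : ℕ+) :
    haarZHat (ZHat.residueClass r n) = ENNReal.ofReal (((n : ℕ) : ℝ)⁻¹) := by
  have htrans : ∀ r, haarZHat (ZHat.residueClass r n) = haarZHat (ZHat.residueClass 0 n) := by
    intro r
    rw [← measure_preimage_add_right haarZHat (-r) (ZHat.residueClass 0 n)]
    congr 1
    ext x
    simp [ZHat.residueClass, sub_eq_add_neg]
  have hunion : (⋃ m ∈ Finset.range n, ZHat.residueClass (m : ZHat) n) = Set.univ := by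
    refine Set.eq_univ_of_forall fun x => ?_
    obtain ⟨m, hlt, hm⟩ := ZHat.exists_lt_sub_dvd n x
    exact Set.mem_biUnion (Finset.mem_coe.2 (Finset.mem_range.2 hlt)) hm
  have hdisj : Set.PairwiseDisjoint (Finset.range n : Set ℕ)
      fun m : ℕ => ZHat.residueClass (m : ZHat) n := by
    intro l hl m hm hlm
    refine Set.disjoint_left.2 fun x hxl hxm => hlm ?_
    have h : ((n : ℕ) : ZHat) ∣ (x - m) - (x - l) := dvd_sub hxm hxl
    rw [sub_sub_sub_cancel_left, ← Int.cast_natCast l, ← Int.cast_natCast m, ← Int.cast_sub,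
      ZHat.natCast_dvd_intCast] at h
    simp only [Finset.coe_range, Set.mem_Iio] at hl hm
    have h0 := Int.eq_zero_of_abs_lt_dvd h (by rw [abs_lt]; omega)
    omega
  have h := measure_biUnion_finset (μ := haarZHat) hdisj
    fun m _ => (ZHat.isClopen_residueClass _ n).isOpen.measurableSet
  rw [hunion, measure_univ, Finset.sum_congr rfl fun (m : ℕ) _ => htrans m, Finset.sum_const,
    Finset.card_range, nsmul_eq_mul] at h
  rw [htrans, ENNReal.ofReal_inv_of_pos (by exact_mod_cast n.pos), ENNReal.ofReal_natCast]
  exact ENNReal.eq_inv_of_mul_eq_one_left (by rw [mul_comm]; exact h.symm)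

/-! ### The symmetric Bost–Connes measures of the sets of multiples -/

theorem measurableSet_multiples {p : PrimeNumber} (c : ℤ_[(p : ℕ)]) :
    MeasurableSet {x : ℤ_[(p : ℕ)] | c ∣ x} := by
  have : {x : ℤ_[(p : ℕ)] | c ∣ x} = Set.range fun b => c * b :=
    Set.ext fun x => ⟨fun ⟨b, hb⟩ => ⟨b, hb.symm⟩, fun ⟨b, hb⟩ => ⟨b, hb.symm⟩⟩
  rw [this]
  exact (isCompact_range (by fun_prop)).isClosed.measurableSet

theorem localBostConnes_multiples {s : ℝ} (hs : 0 < s) (p : PrimeNumber) (k : ℕ) :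
    localBostConnes s p {x | ((p : ℕ) : ℤ_[(p : ℕ)]) ^ k ∣ x} =
      ENNReal.ofReal ((((p : ℕ) : ℝ) ^ k) ^ (-s)) := by
  set q : ℝ := ((p : ℕ) : ℝ) ^ (-s) with hq
  have hp0 : (0 : ℝ) ≤ ((p : ℕ) : ℝ) := by positivity
  have hp1 : (1 : ℝ) < ((p : ℕ) : ℝ) := by exact_mod_cast p.2.one_lt
  have hq0 : 0 ≤ q := by positivity
  have hq1 : q < 1 := Real.rpow_lt_one_of_one_lt_of_neg hp1 (by linarith)
  have hpow : ∀ n : ℕ, ((p : ℕ) : ℝ) ^ (-(n * s)) = q ^ n := fun n => by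
    rw [hq, ← Real.rpow_natCast, ← Real.rpow_mul hp0]
    congr 1
    ring
  have hdvd : ∀ n : ℕ, ((p : ℕ) : ℤ_[(p : ℕ)]) ^ k ∣ ((p : ℕ) : ℤ_[(p : ℕ)]) ^ n ↔ k ≤ n :=
    fun n => pow_dvd_pow_iff PadicInt.prime_p.ne_zero PadicInt.prime_p.not_isUnit
  have hterm : ∀ n : ℕ, (ENNReal.ofReal (((p : ℕ) : ℝ) ^ (-(n * s)) * (1 - q)) •
      Measure.dirac (((p : ℕ) : ℤ_[(p : ℕ)]) ^ n)) {x | ((p : ℕ) : ℤ_[(p : ℕ)]) ^ k ∣ x} =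
      if k ≤ n then ENNReal.ofReal (q ^ n * (1 - q)) else 0 := by
    intro n
    rw [Measure.smul_apply, Measure.dirac_apply' _ (measurableSet_multiples _), hpow]
    split_ifs with h
    · rw [Set.indicator_of_mem (by exact (hdvd n).2 h), Pi.one_apply, smul_eq_mul, mul_one]
    · rw [Set.indicator_of_notMem (by exact fun hn => h ((hdvd n).1 hn)), smul_zero]
  rw [localBostConnes, Measure.sum_apply _ (measurableSet_multiples _)]
  simp only [← hq]
  rw [tsum_congr hterm,
    ← Summable.sum_add_tsum_nat_add' (k := k) ENNReal.summable, Finset.sum_eq_zero, zero_add]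
  · have hgeom : ∀ n : ℕ, q ^ (n + k) * (1 - q) = q ^ k * (1 - q) * q ^ n := fun n => by ring
    have hsum : Summable fun n : ℕ => q ^ k * (1 - q) * q ^ n :=
      (summable_geometric_of_lt_one hq0 hq1).mul_left _
    simp only [le_add_iff_nonneg_left, zero_le, if_true, hgeom]
    have hq1' : 0 ≤ 1 - q := by linarith
    rw [← ENNReal.ofReal_tsum_of_nonneg (fun n => by positivity) hsum, tsum_mul_left,
      tsum_geometric_of_lt_one hq0 hq1, mul_assoc, mul_inv_cancel₀ (by linarith), mul_one, hq,
      ← Real.rpow_natCast, ← Real.rpow_natCast, ← Real.rpow_mul hp0, ← Real.rpow_mul hp0, mul_comm]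
  · intro n hn
    rw [if_neg (by simpa using hn)]

theorem isProbabilityMeasure_localBostConnes {s : ℝ} (hs : 0 < s) (p : PrimeNumber) :
    IsProbabilityMeasure (localBostConnes s p) :=
  ⟨by simpa using localBostConnes_multiples hs p 0⟩

/-- Divisibility by `n` is a condition on the coordinates at the prime factors of `n`. -/
theorem ZHat.natCast_dvd_iff_forall_mem_primeFactors (n : ℕ+) (a : ZHat) :
    ((n : ℕ) : ZHat) ∣ a ↔ ∀ p ∈ (n : ℕ).primeFactors.subtype Nat.Prime,
      ((p : ℕ) : ℤ_[(p : ℕ)]) ^ (n : ℕ).factorization p ∣ a p := by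
  simp only [← ZHat.prime_pow_dvd_iff, Finset.mem_subtype]
  constructor
  · exact fun h p _ => (Nat.cast_dvd_cast (Nat.ordProj_dvd _ _)).trans h
  · intro h
    rw [pi_dvd_iff]
    intro p
    by_cases hp : (p : ℕ) ∣ n
    · have h1 := (ZHat.prime_pow_dvd_iff p _ a).1
        (h p (Nat.mem_primeFactors.2 ⟨p.2, hp, n.ne_zero⟩))
      obtain ⟨u, hu⟩ := ZHat.isUnit_natCast (Nat.not_dvd_ordCompl p.2 n.ne_zero)
      rw [Pi.natCast_apply, ← Nat.ordProj_mul_ordCompl_eq_self n p, Nat.cast_mul, ← hu,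
        Units.mul_right_dvd, Nat.cast_pow]
      exact h1
    · exact (ZHat.isUnit_natCast hp).dvd

theorem symBostConnes_range_smul {s : ℝ} (hs : 0 ≤ s) (n : ℕ+) :
    symBostConnes s (Set.range fun a : SupNat => n • a) =
      ENNReal.ofReal (((n : ℕ) : ℝ) ^ (-s)) := by
  have hmeas : MeasurableSet (Set.range fun a : SupNat => n • a) :=
    (SupNat.isClopen_range_smul n).isOpen.measurableSet
  rcases hs.eq_or_lt with rfl | hs
  · rw [symBostConnes, if_pos rfl, Measure.dirac_apply' _ hmeas,
      Set.indicator_of_mem (SupNat.mk_mem_range_smul.2 (dvd_zero _))]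
    simp
  · have := isProbabilityMeasure_localBostConnes hs
    have hpre : SupNat.mk ⁻¹' (Set.range fun a : SupNat => n • a) =
        Set.pi ((n : ℕ).primeFactors.subtype Nat.Prime : Finset PrimeNumber)
          fun p : PrimeNumber => {x | ((p : ℕ) : ℤ_[(p : ℕ)]) ^ (n : ℕ).factorization p ∣ x} := by
      ext a
      exact SupNat.mk_mem_range_smul.trans (ZHat.natCast_dvd_iff_forall_mem_primeFactors n a)
    rw [symBostConnes, if_neg hs.ne', Measure.map_apply SupNat.continuous_mk.measurable hmeas,
      hpre, Measure.infinitePi_pi _ fun p _ => measurableSet_multiples _,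
      Finset.prod_congr rfl fun p _ => localBostConnes_multiples hs p _,
      ← ENNReal.ofReal_prod_of_nonneg fun p _ => by positivity,
      Real.finsetProd_rpow _ _ fun p _ => by positivity,
      Finset.prod_subtype_of_mem (fun p : ℕ => (p : ℝ) ^ (n : ℕ).factorization p)
        fun p hp => Nat.prime_of_mem_primeFactors hp]
    congr 2
    exact_mod_cast Nat.prod_factorization_pow_eq_self n.ne_zero

theorem isProbabilityMeasure_symBostConnes {s : ℝ} (hs : 0 ≤ s) :
    IsProbabilityMeasure (symBostConnes s) :=
  ⟨by simpa using symBostConnes_range_smul hs 1⟩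

theorem scaling_symBostConnes {s : ℝ} (hs : 0 ≤ s) : SupNat.Scaling s (symBostConnes s) :=
  have := isProbabilityMeasure_symBostConnes hs
  SupNat.scaling_iff.2 (symBostConnes_range_smul hs)

/-! ### The scaling measures on `Ω_B` -/

namespace OmegaB

/-- The image of the product of the Haar measure with a symmetric Bost–Connes measure. -/
def scalingMeasure (β : ℝ) : Measure OmegaB := (haarZHat.prod (symBostConnes (β - 1))).map proj

theorem isProbabilityMeasure_scalingMeasure {β : ℝ} (hβ : 1 ≤ β) :
    IsProbabilityMeasure (scalingMeasure β) :=
  have := isProbabilityMeasure_symBostConnes (sub_nonneg.2 hβ)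
  Measure.isProbabilityMeasure_map continuous_proj.measurable.aemeasurable

theorem scaling_scalingMeasure {β : ℝ} (hβ : 1 ≤ β) : Scaling β (scalingMeasure β) := by
  have := isProbabilityMeasure_symBostConnes (sub_nonneg.2 hβ)
  have := isProbabilityMeasure_scalingMeasure hβ
  refine scaling_iff.2 fun x => ?_
  have hx : (0 : ℝ) < ((x.scale : ℕ) : ℝ) := by exact_mod_cast x.scale.pos
  rw [scalingMeasure, Measure.map_apply continuous_proj.measurable
    (isClopen_cyl x).isOpen.measurableSet, preimage_proj_cyl, Measure.prod_prod,
    haarZHat_residueClass, symBostConnes_range_smul (sub_nonneg.2 hβ),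
    ← ENNReal.ofReal_mul (by positivity), ← Real.rpow_neg_one, ← Real.rpow_add hx]
  congr 2
  ring

end OmegaB

open CrossedProduct

/-! ### Extension by zero and the relations in the crossed product -/

namespace OmegaB

/-- The function `f (x⁻¹ ·)`, extended by `0` outside `x • Ω_B`; it is continuous because `x • Ω_B`
is clopen. -/
def shift (x : AffSemigroup) (f : C(OmegaB, ℂ)) : C(OmegaB, ℂ) where
  toFun := Function.extend (fun ω : OmegaB => x • ω) f 0
  continuous_toFun := by
    rw [continuous_iff_continuousAt]
    intro ω
    by_cases hω : ω ∈ cyl x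
    · obtain ⟨ω, rfl⟩ := hω
      rw [← (isOpenEmbedding_smul x).continuousAt_iff, Function.extend_comp (smul_injective x)]
      exact f.continuous.continuousAt
    · refine (continuousAt_const (y := (0 : ℂ))).congr ?_
      filter_upwards [(isClopen_cyl x).compl.isOpen.mem_nhds hω] with ω' hω'
      exact (Function.extend_apply' f (0 : OmegaB → ℂ) ω' hω').symm

theorem shift_smul (x : AffSemigroup) (f : C(OmegaB, ℂ)) (ω : OmegaB) :
    shift x f (x • ω) = f ω :=
  (smul_injective x).extend_apply f 0 ω

theorem shift_of_notMem {x : AffSemigroup} {ω : OmegaB} (f : C(OmegaB, ℂ)) (h : ω ∉ cyl x) :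
    shift x f ω = 0 :=
  Function.extend_apply' _ _ _ h

open Classical in
theorem shift_one_apply (x : AffSemigroup) (ω : OmegaB) :
    shift x 1 ω = if ω ∈ cyl x then 1 else 0 := by
  split_ifs with h
  · obtain ⟨ω, rfl⟩ := h
    exact shift_smul x 1 ω
  · exact shift_of_notMem _ h

/-- The function `ω ↦ f (x • ω)`. -/
def pull (x : AffSemigroup) (f : C(OmegaB, ℂ)) : C(OmegaB, ℂ) :=
  f.comp ⟨fun ω : OmegaB => x • ω, continuous_const_smul x⟩

theorem pull_apply (x : AffSemigroup) (f : C(OmegaB, ℂ)) (ω : OmegaB) :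
    pull x f ω = f (x • ω) := rfl

end OmegaB

open OmegaB

namespace Alg

theorem star_v_mul_v (x : AffSemigroup) : star (v x : Alg) * v x = 1 :=
  (univ OmegaB AffSemigroup).isometry x

theorem v_mul_ι_mul_star_v (x : AffSemigroup) (f : C(OmegaB, ℂ)) :
    (v x * ι f * star (v x) : Alg) = ι (shift x f) :=
  (univ OmegaB AffSemigroup).covariant x f _ rfl

theorem v_mul_star_v (x : AffSemigroup) : (v x * star (v x) : Alg) = ι (shift x 1) := by
  rw [← v_mul_ι_mul_star_v, map_one, mul_one]

theorem v_mul_ι (x : AffSemigroup) (f : C(OmegaB, ℂ)) :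
    (v x * ι f : Alg) = ι (shift x f) * v x := by
  rw [← v_mul_ι_mul_star_v, mul_assoc (v x * ι f), star_v_mul_v, mul_one]

theorem ι_mul_star_v (x : AffSemigroup) (f : C(OmegaB, ℂ)) :
    (ι f * star (v x) : Alg) = star (v x) * ι (shift x f) := by
  rw [← v_mul_ι_mul_star_v, ← mul_assoc, ← mul_assoc, star_v_mul_v, one_mul]

/-- The elements `(v x)⋆ * ι f * v y`, which span a dense ⋆-subalgebra by the Ore condition. -/
def monomial (x : AffSemigroup) (f : C(OmegaB, ℂ)) (y : AffSemigroup) : Alg :=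
  star (v x) * ι f * v y

theorem monomial_one_one (f : C(OmegaB, ℂ)) : monomial 1 f 1 = ι f := by
  rw [monomial, map_one, star_one, one_mul, mul_one]

theorem star_monomial (x y : AffSemigroup) (f : C(OmegaB, ℂ)) :
    star (monomial x f y) = monomial y (star f) x := by
  rw [monomial, monomial, star_mul, star_mul, star_star, map_star, mul_assoc]

theorem v_mul_star_v_of_mul_eq {x y z w : AffSemigroup} (h : z * y = w * x) :
    (v y * star (v x) : Alg) = star (v z) * v w * ι (shift x 1) := by
  rw [← v_mul_star_v, ← mul_assoc, mul_assoc _ (v w), ← map_mul, ← h, map_mul, ← mul_assoc,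
    star_v_mul_v, one_mul]

/-- Products of monomials are monomials: the Ore condition moves the inner adjoint to the left. -/
theorem exists_monomial_mul_monomial (x y x' y' : AffSemigroup) (f f' : C(OmegaB, ℂ)) :
    ∃ z g w, monomial x f y * monomial x' f' y' = monomial z g w := by
  obtain ⟨z, w, h⟩ := AffSemigroup.exists_mul_eq_mul y x'
  refine ⟨z * x, shift z f * shift w (shift x' 1 * f'), w * y', ?_⟩
  calc monomial x f y * monomial x' f' y'
      = star (v x) * ι f * (v y * star (v x')) * ι f' * v y' := by
        simp only [monomial, mul_assoc]
    _ = star (v x) * (ι f * star (v z)) * (v w * ι (shift x' 1 * f')) * v y' := by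
        rw [v_mul_star_v_of_mul_eq h, map_mul]
        simp only [mul_assoc]
    _ = monomial (z * x) (shift z f * shift w (shift x' 1 * f')) (w * y') := by
        rw [ι_mul_star_v, v_mul_ι, monomial]
        simp only [map_mul, star_mul, mul_assoc]

/-- The linear span of the monomials. -/
def monomialSpan : Submodule ℂ Alg :=
  Submodule.span ℂ {a | ∃ x f y, monomial x f y = a}

theorem monomial_mem (x : AffSemigroup) (f : C(OmegaB, ℂ)) (y : AffSemigroup) :
    monomial x f y ∈ monomialSpan :=
  Submodule.subset_span ⟨x, f, y, rfl⟩

theorem mul_mem_monomialSpan {a b : Alg} (ha : a ∈ monomialSpan) (hb : b ∈ monomialSpan) :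
    a * b ∈ monomialSpan := by
  have h : monomialSpan * monomialSpan ≤ monomialSpan := by
    rw [monomialSpan, Submodule.span_mul_span, Submodule.span_le]
    rintro _ ⟨_, ⟨x, f, y, rfl⟩, _, ⟨x', f', y', rfl⟩, rfl⟩
    obtain ⟨z, g, w, h⟩ := exists_monomial_mul_monomial x y x' y' f f'
    exact Submodule.subset_span ⟨z, g, w, h.symm⟩
  exact h (Submodule.mul_mem_mul ha hb)

theorem star_mem_monomialSpan {a : Alg} (ha : a ∈ monomialSpan) : star a ∈ monomialSpan := by
  induction ha using Submodule.span_induction with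
  | mem a ha =>
    obtain ⟨x, f, y, rfl⟩ := ha
    rw [star_monomial]
    exact monomial_mem _ _ _
  | zero => rw [star_zero]; exact zero_mem _
  | add a b _ _ ha hb => rw [star_add]; exact add_mem ha hb
  | smul c a _ ha => rw [star_smul]; exact Submodule.smul_mem _ _ ha

theorem ι_mem_monomialSpan (f : C(OmegaB, ℂ)) : ι f ∈ monomialSpan :=
  monomial_one_one f ▸ monomial_mem 1 f 1

theorem dense_monomialSpan : Dense (monomialSpan : Set Alg) := by
  refine (dense_range_eval (X := OmegaB) (S := AffSemigroup)).mono ?_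
  rintro _ ⟨e, rfl⟩
  change _ ∈ monomialSpan
  induction e with
  | fn f => exact ι_mem_monomialSpan f
  | iso x =>
    have h : monomial 1 1 x = v x := by
      rw [monomial, map_one, map_one, star_one, one_mul, one_mul]
    change v x ∈ monomialSpan
    exact h ▸ monomial_mem 1 1 x
  | const c =>
    have h : algebraMap ℂ Alg c = c • ι 1 := by rw [map_one, Algebra.algebraMap_eq_smul_one]
    rw [CovariantRep.eval, h]
    exact Submodule.smul_mem _ _ (ι_mem_monomialSpan 1)
  | add a b ha hb => exact add_mem ha hb
  | mul a b ha hb => exact mul_mem_monomialSpan ha hb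
  | adj a ha => exact star_mem_monomialSpan ha

theorem continuousLinearMap_ext {F : Type*} [NormedAddCommGroup F] [NormedSpace ℂ F]
    {T T' : Alg →L[ℂ] F} (h : ∀ x f y, T (monomial x f y) = T' (monomial x f y)) : T = T' := by
  refine ContinuousLinearMap.ext_on dense_monomialSpan ?_
  rintro _ ⟨x, f, y, rfl⟩
  exact h x f y

end Alg

/-! ### The left regular representation -/

/-- The Hilbert space `ℓ²(ℤ ⋊ ℕˣ)`. -/
abbrev Ell2 : Type := lp (fun _ : AffSemigroup => ℂ) 2

namespace Ell2

open Classical in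
/-- The standard orthonormal basis. -/
def basisVec (s : AffSemigroup) : Ell2 := lp.single 2 s 1

open Classical in
theorem basisVec_apply (s t : AffSemigroup) : basisVec s t = if t = s then 1 else 0 := by
  rw [basisVec, lp.single_apply, Pi.single_apply]

theorem basisVec_mul_apply (x s t : AffSemigroup) : basisVec (x * s) (x * t) = basisVec s t := by
  classical
  rw [basisVec_apply, basisVec_apply]
  exact if_congr ⟨fun h => mul_left_cancel h, fun h => h ▸ rfl⟩ rfl rfl

theorem inner_basisVec (s : AffSemigroup) (ξ : Ell2) : inner ℂ (basisVec s) ξ = ξ s := by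
  classical
  rw [basisVec, lp.inner_single_left]
  simp

theorem norm_basisVec (s : AffSemigroup) : ‖basisVec s‖ = 1 := by
  classical
  rw [basisVec, lp.norm_single (by norm_num), norm_one]

theorem operator_ext {A B : Ell2 →L[ℂ] Ell2} (h : ∀ s, A (basisVec s) = B (basisVec s)) :
    A = B := by
  classical
  refine lp.ext_continuousLinearMap ENNReal.ofNat_ne_top fun s => ?_
  refine ContinuousLinearMap.ext_ring ?_
  have h1 := h s
  rw [basisVec] at h1
  convert! h1

theorem orthonormal_basisVec_mul (x : AffSemigroup) :
    Orthonormal ℂ fun s => basisVec (x * s) := by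
  refine ⟨fun s => norm_basisVec _, fun s t hst => ?_⟩
  change inner ℂ (basisVec (x * s)) (basisVec (x * t)) = 0
  rw [inner_basisVec, basisVec_apply, if_neg fun h => hst (mul_left_cancel h)]

/-- The isometry `δ_s ↦ δ_{x s}`. -/
def translation (x : AffSemigroup) : Ell2 →ₗᵢ[ℂ] Ell2 :=
  (orthonormal_basisVec_mul x).orthogonalFamily.linearIsometry

theorem translation_basisVec (x s : AffSemigroup) :
    translation x (basisVec s) = basisVec (x * s) := by
  classical
  rw [translation, basisVec, OrthogonalFamily.linearIsometry_apply_single]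
  exact one_smul ℂ _

theorem star_translation_apply (x : AffSemigroup) (ξ : Ell2) (s : AffSemigroup) :
    star (translation x).toContinuousLinearMap ξ s = ξ (x * s) := by
  rw [← inner_basisVec, ContinuousLinearMap.star_eq_adjoint,
    ContinuousLinearMap.adjoint_inner_right, LinearIsometry.coe_toContinuousLinearMap,
    translation_basisVec, inner_basisVec]

/-- The diagonal operator with entries the values of `f` along the orbit of the origin. -/
def diagonal (f : C(OmegaB, ℂ)) : Ell2 →L[ℂ] Ell2 :=
  lp.mapCLM 2 (fun s : AffSemigroup => f (s • origin) • ContinuousLinearMap.id ℂ ℂ)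
    (norm_nonneg f) fun s => by
      rw [norm_smul, ContinuousLinearMap.norm_id, mul_one]
      exact f.norm_coe_le_norm _

theorem diagonal_apply (f : C(OmegaB, ℂ)) (ξ : Ell2) (s : AffSemigroup) :
    diagonal f ξ s = f (s • origin) * ξ s := rfl

theorem diagonal_basisVec (f : C(OmegaB, ℂ)) (s : AffSemigroup) :
    diagonal f (basisVec s) = f (s • origin) • basisVec s := by
  refine lp.ext (funext fun t => ?_)
  rw [diagonal_apply, lp.coeFn_smul, Pi.smul_apply, basisVec_apply, smul_eq_mul]
  split_ifs with h
  · rw [h]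
  · rw [mul_zero, mul_zero]

/-- The left regular representation. Covariance holds since `s • origin` lies in `x • Ω_B` only if
`s` is a multiple of `x`. -/
def regularRep : CovariantRep OmegaB AffSemigroup (Ell2 →L[ℂ] Ell2) where
  ι :=
    { toFun := diagonal
      map_one' := operator_ext fun s => by
        rw [diagonal_basisVec]
        exact one_smul _ _
      map_mul' := fun f g => operator_ext fun s => by
        rw [mul_apply_eq_comp, diagonal_basisVec, diagonal_basisVec, (diagonal f).map_smul,
          diagonal_basisVec, smul_smul, mul_comm]
        rfl
      map_zero' := operator_ext fun s => by
        rw [diagonal_basisVec]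
        exact zero_smul _ _
      map_add' := fun f g => operator_ext fun s => by
        rw [add_apply, diagonal_basisVec, diagonal_basisVec, diagonal_basisVec,
          ← add_smul]
        rfl
      commutes' := fun c => operator_ext fun s => by
        rw [diagonal_basisVec, Algebra.algebraMap_eq_smul_one, Algebra.algebraMap_eq_smul_one]
        simp
      map_star' := fun f => by
        rw [ContinuousLinearMap.star_eq_adjoint]
        refine (ContinuousLinearMap.eq_adjoint_iff _ _).2 fun ξ η => ?_
        rw [lp.inner_eq_tsum, lp.inner_eq_tsum]
        refine tsum_congr fun s => ?_
        rw [diagonal_apply, diagonal_apply, RCLike.inner_apply, RCLike.inner_apply, map_mul]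
        simp only [ContinuousMap.star_apply, RCLike.star_def, RingHomCompTriple.comp_apply,
          RingHom.id_apply]
        ring }
  v :=
    { toFun := fun x => (translation x).toContinuousLinearMap
      map_one' := operator_ext fun s => by
        rw [LinearIsometry.coe_toContinuousLinearMap, translation_basisVec, one_mul]
        rfl
      map_mul' := fun x y => operator_ext fun s => by
        rw [mul_apply_eq_comp]
        simp only [LinearIsometry.coe_toContinuousLinearMap, translation_basisVec, mul_assoc] }
  isometry x := operator_ext fun s => lp.ext <| funext fun t => by
    simp only [MonoidHom.coe_mk, OneHom.coe_mk, mul_apply_eq_comp,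
      LinearIsometry.coe_toContinuousLinearMap, one_apply_eq_self]
    rw [star_translation_apply, translation_basisVec, basisVec_mul_apply]
  covariant x f g hg := operator_ext fun s => by
    have hshift : g = shift x f := ContinuousMap.coe_injective hg
    simp only [MonoidHom.coe_mk, OneHom.coe_mk, mul_apply_eq_comp,
      LinearIsometry.coe_toContinuousLinearMap, StarAlgHom.coe_mk', AlgHom.coe_mk, RingHom.coe_mk,
      hshift]
    change translation x (diagonal f (star (translation x).toContinuousLinearMap (basisVec s))) =
      diagonal (shift x f) (basisVec s)
    rw [diagonal_basisVec]
    by_cases hs : ∃ t, s = x * t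
    · obtain ⟨t, rfl⟩ := hs
      have h1 : star (translation x).toContinuousLinearMap (basisVec (x * t)) = basisVec t := by
        refine lp.ext (funext fun u => ?_)
        rw [star_translation_apply, basisVec_mul_apply]
      rw [h1, diagonal_basisVec, map_smul, translation_basisVec, mul_smul, shift_smul]
    · have h1 : star (translation x).toContinuousLinearMap (basisVec s) = 0 := by
        refine lp.ext (funext fun u => ?_)
        rw [star_translation_apply, basisVec_apply, if_neg fun h => hs ⟨u, h.symm⟩]
        rfl
      rw [h1, map_zero, map_zero, shift_of_notMem _ fun h => hs (smul_origin_mem_cyl.1 h),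
        zero_smul]

/-- The homomorphism out of the crossed product given by the left regular representation. -/
def regular : Alg →⋆ₐ[ℂ] (Ell2 →L[ℂ] Ell2) := lift regularRep

theorem regular_ι (f : C(OmegaB, ℂ)) : regular (ι f) = diagonal f :=
  (existsUnique_lift regularRep).choose_spec.1.1 f

theorem regular_v (x : AffSemigroup) : regular (v x) = (translation x).toContinuousLinearMap :=
  (existsUnique_lift regularRep).choose_spec.1.2 x

theorem norm_regular_apply_le (a : Alg) (s : AffSemigroup) :
    ‖regular a (basisVec s) s‖ ≤ ‖a‖ :=
  calc ‖regular a (basisVec s) s‖ ≤ ‖regular a (basisVec s)‖ :=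
        lp.norm_apply_le_norm two_ne_zero _ s
    _ ≤ ‖regular a‖ := by
        simpa only [norm_basisVec, mul_one] using (regular a).le_opNorm (basisVec s)
    _ ≤ ‖a‖ := NonUnitalStarAlgHom.norm_apply_le regular a

open Classical in
/-- The diagonal matrix coefficients of a monomial. -/
theorem regular_monomial_apply (x y s : AffSemigroup) (f : C(OmegaB, ℂ)) :
    regular (Alg.monomial x f y) (basisVec s) s = if x = y then f (x • s • origin) else 0 := by
  rw [Alg.monomial, map_mul, map_mul, map_star, regular_ι, regular_v, regular_v,
    mul_apply_eq_comp, mul_apply_eq_comp, star_translation_apply,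
    LinearIsometry.coe_toContinuousLinearMap, translation_basisVec, diagonal_basisVec,
    lp.coeFn_smul, Pi.smul_apply, basisVec_apply, smul_eq_mul, mul_ite, mul_one, mul_zero]
  have h : x * s = y * s ↔ x = y := ⟨fun h => mul_right_cancel h, fun h => h ▸ rfl⟩
  simp only [h]
  split_ifs with hxy
  · rw [hxy, mul_smul]
  · rfl

end Ell2

/-! ### The canonical conditional expectation -/

open Ell2

/-- The diagonal matrix coefficients in the left regular representation. -/
def coefficients : Alg →L[ℂ] lp (fun _ : AffSemigroup => ℂ) ∞ :=
  LinearMap.mkContinuous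
    { toFun := fun a => ⟨fun s => regular a (basisVec s) s, memℓp_infty ⟨‖a‖, by
        rintro _ ⟨s, rfl⟩; exact norm_regular_apply_le a s⟩⟩
      map_add' := fun a b => lp.ext (funext fun s => by
        rw [lp.coeFn_add]
        simp only [map_add, add_apply, lp.coeFn_add, Pi.add_apply])
      map_smul' := fun c a => lp.ext (funext fun s => by
        rw [lp.coeFn_smul]
        simp only [map_smul, smul_apply, lp.coeFn_smul, Pi.smul_apply,
          RingHom.id_apply]) }
    1 fun a => by
      rw [one_mul]
      exact lp.norm_le_of_forall_le (norm_nonneg a) (norm_regular_apply_le a)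

theorem coefficients_apply (a : Alg) (s : AffSemigroup) :
    coefficients a s = regular a (basisVec s) s := rfl

theorem norm_coefficients_le (a : Alg) : ‖coefficients a‖ ≤ ‖a‖ :=
  lp.norm_le_of_forall_le (norm_nonneg a) (norm_regular_apply_le a)

/-- Restriction of functions to the orbit of the origin; it is isometric since the orbit is
dense. -/
def orbitRestriction : C(OmegaB, ℂ) →ₗᵢ[ℂ] lp (fun _ : AffSemigroup => ℂ) ∞ where
  toFun f := ⟨fun s => f (s • origin), memℓp_infty ⟨‖f‖, by
    rintro _ ⟨s, rfl⟩; exact f.norm_coe_le_norm _⟩⟩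
  map_add' _ _ := rfl
  map_smul' _ _ := rfl
  norm_map' f := by
    refine le_antisymm (lp.norm_le_of_forall_le (norm_nonneg f) fun s => f.norm_coe_le_norm _) ?_
    refine (ContinuousMap.norm_le _ (norm_nonneg _)).2 fun ω => ?_
    refine denseRange_smul_origin.induction_on ω (isClosed_le (by fun_prop) continuous_const)
      fun s => ?_
    exact lp.norm_apply_le_norm ENNReal.top_ne_zero
      (⟨fun s => f (s • origin), _⟩ : lp (fun _ : AffSemigroup => ℂ) ∞) s

theorem orbitRestriction_apply (f : C(OmegaB, ℂ)) (s : AffSemigroup) :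
    orbitRestriction f s = f (s • origin) := rfl

theorem coefficients_monomial_self (x : AffSemigroup) (f : C(OmegaB, ℂ)) :
    coefficients (Alg.monomial x f x) = orbitRestriction (pull x f) :=
  lp.ext (funext fun s => by
    rw [coefficients_apply, regular_monomial_apply, if_pos rfl, orbitRestriction_apply, pull_apply])

theorem coefficients_monomial_of_ne {x y : AffSemigroup} (h : x ≠ y) (f : C(OmegaB, ℂ)) :
    coefficients (Alg.monomial x f y) = 0 :=
  lp.ext (funext fun s => by
    rw [coefficients_apply, regular_monomial_apply, if_neg h]; rfl)

/-- Diagonal matrix coefficients are continuous functions on `Ω_B`: this holds for monomials, and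
the restrictions of continuous functions form a closed subspace. -/
theorem coefficients_mem_range (a : Alg) :
    coefficients a ∈ LinearMap.range orbitRestriction.toLinearMap := by
  have hcl : IsClosed (Set.range orbitRestriction) :=
    orbitRestriction.isometry.isClosedEmbedding.isClosed_range
  have h : closure (Alg.monomialSpan : Set Alg) ⊆ coefficients ⁻¹' Set.range orbitRestriction := by
    refine closure_minimal ?_ (hcl.preimage coefficients.continuous)
    change Alg.monomialSpan ≤
      (LinearMap.range orbitRestriction.toLinearMap).comap coefficients.toLinearMap
    refine Submodule.span_le.2 ?_
    rintro _ ⟨x, f, y, rfl⟩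
    by_cases hxy : x = y
    · subst hxy
      exact ⟨pull x f, (coefficients_monomial_self x f).symm⟩
    · exact ⟨0, (map_zero _).trans (coefficients_monomial_of_ne hxy f).symm⟩
  exact h (Alg.dense_monomialSpan a)

/-- The canonical conditional expectation: the function with the given diagonal matrix
coefficients. -/
def expectation : Alg →L[ℂ] C(OmegaB, ℂ) :=
  (orbitRestriction.equivRange.symm : _ →L[ℂ] C(OmegaB, ℂ)).comp
    (coefficients.codRestrict _ coefficients_mem_range)

theorem orbitRestriction_expectation (a : Alg) :
    orbitRestriction (expectation a) = coefficients a :=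
  congrArg Subtype.val
    (orbitRestriction.equivRange.apply_symm_apply ⟨coefficients a, coefficients_mem_range a⟩)

theorem expectation_smul_origin (a : Alg) (s : AffSemigroup) :
    expectation a (s • origin) = regular a (basisVec s) s := by
  rw [← orbitRestriction_apply, orbitRestriction_expectation, coefficients_apply]

theorem expectation_monomial_self (x : AffSemigroup) (f : C(OmegaB, ℂ)) :
    expectation (Alg.monomial x f x) = pull x f :=
  orbitRestriction.injective
    ((orbitRestriction_expectation _).trans (coefficients_monomial_self x f))

theorem expectation_monomial_of_ne {x y : AffSemigroup} (h : x ≠ y) (f : C(OmegaB, ℂ)) :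
    expectation (Alg.monomial x f y) = 0 :=
  orbitRestriction.injective ((orbitRestriction_expectation _).trans
    ((coefficients_monomial_of_ne h f).trans (map_zero _).symm))

theorem expectation_ι (f : C(OmegaB, ℂ)) : expectation (ι f) = f := by
  rw [← Alg.monomial_one_one, expectation_monomial_self]
  ext ω
  rw [pull_apply, one_smul]

theorem isCanonicalExpectation_expectation : IsCanonicalExpectation expectation where
  map_ι := expectation_ι
  norm_le a := by
    rw [← orbitRestriction.norm_map, orbitRestriction_expectation]
    exact norm_coefficients_le a
  map_self := expectation_monomial_self
  map_ne _ _ f h := expectation_monomial_of_ne h f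

theorem eq_expectation {E : Alg →L[ℂ] C(OmegaB, ℂ)} (hE : IsCanonicalExpectation E) :
    E = expectation := by
  refine Alg.continuousLinearMap_ext fun x f y => ?_
  by_cases hxy : x = y
  · subst hxy
    exact (hE.map_self x f).trans (expectation_monomial_self x f).symm
  · exact (hE.map_ne x y f hxy).trans (expectation_monomial_of_ne hxy f).symm

/-- The conditional expectation is positive, since `⟨δ_s, a⋆ a δ_s⟩ = ‖a δ_s‖²`. -/
theorem expectation_star_mul_self (a : Alg) (ω : OmegaB) :
    0 ≤ (expectation (star a * a) ω).re ∧ (expectation (star a * a) ω).im = 0 := by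
  refine denseRange_smul_origin.induction_on ω ?_ fun s => ?_
  · have h := (expectation (star a * a)).continuous
    exact (isClosed_le continuous_const (continuous_re.comp h)).inter
      (isClosed_eq (continuous_im.comp h) continuous_const)
  · rw [expectation_smul_origin, map_mul, map_star, mul_apply_eq_comp,
      ← inner_basisVec, ContinuousLinearMap.star_eq_adjoint,
      ContinuousLinearMap.adjoint_inner_right, inner_self_eq_norm_sq_to_K]
    rw [← RCLike.ofReal_pow]
    exact ⟨sq_nonneg _, ofReal_im _⟩

open CrossedProduct OmegaB Ell2

/-! ### The dynamics and its eigenvectors -/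

/-- The dynamics as a continuous linear map. -/
def σL (t : ℝ) : Alg →L[ℂ] Alg := ⟨(σ t).toAlgHom.toLinearMap, continuous_hom (σ t)⟩

/-- Left multiplication as a continuous linear map. -/
def mulLeftL (b : Alg) : Alg →L[ℂ] Alg := ⟨LinearMap.mulLeft ℂ b, continuous_const_mul b⟩

/-- Right multiplication as a continuous linear map. -/
def mulRightL (b : Alg) : Alg →L[ℂ] Alg := ⟨LinearMap.mulRight ℂ b, continuous_mul_const b⟩

theorem mulLeftL_apply (b a : Alg) : mulLeftL b a = b * a := rfl

theorem mulRightL_apply (b a : Alg) : mulRightL b a = a * b := rfl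

theorem σL_apply (t : ℝ) (a : Alg) : σL t a = σ t a := rfl

/-- The elements `b` with `σ t b = exp (i t l) b` for all `t`. -/
def IsEigenvector (l : ℝ) (b : Alg) : Prop := ∀ t : ℝ, σ t b = exp (I * t * l) • b

theorem isEigenvector_ι (f : C(OmegaB, ℂ)) : IsEigenvector 0 (ι f) := fun t => by
  rw [ofReal_zero, mul_zero, exp_zero, one_smul]
  exact (existsUnique_lift (twistRep (AffSemigroup.character t))).choose_spec.1.1 f

theorem isEigenvector_v (x : AffSemigroup) : IsEigenvector (Real.log (x.scale : ℕ)) (v x) :=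
  fun t => by
    refine ((existsUnique_lift (twistRep (AffSemigroup.character t))).choose_spec.1.2 x).trans ?_
    change ((Circle.exp (t * Real.log (x.scale : ℕ)) : Circle) : ℂ) • (v x : Alg) = _
    rw [Circle.coe_exp]
    congr 2
    push_cast
    ring

theorem IsEigenvector.star {l : ℝ} {b : Alg} (h : IsEigenvector l b) :
    IsEigenvector (-l) (star b) := fun t => by
  rw [map_star, h t, star_smul, RCLike.star_def, ← exp_conj]
  congr 2
  simp

theorem IsEigenvector.mul {l l' : ℝ} {b b' : Alg} (h : IsEigenvector l b)
    (h' : IsEigenvector l' b') : IsEigenvector (l + l') (b * b') := fun t => by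
  rw [map_mul, h t, h' t, smul_mul_smul_comm, ← exp_add]
  congr 2
  push_cast
  ring

theorem isEigenvector_monomial (x y : AffSemigroup) (f : C(OmegaB, ℂ)) :
    IsEigenvector (-Real.log (x.scale : ℕ) + 0 + Real.log (y.scale : ℕ)) (Alg.monomial x f y) :=
  ((isEigenvector_v x).star.mul (isEigenvector_ι f)).mul (isEigenvector_v y)

theorem IsEigenvector.isEntireExtension {l : ℝ} {b : Alg} (h : IsEigenvector l b) :
    IsEntireExtension b fun z => exp (I * z * l) • b :=
  ⟨by fun_prop, fun t => (h t).symm⟩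

theorem exp_I_mul_I_mul (β l : ℝ) : exp (I * (I * β) * l) = (Real.exp (-β * l) : ℝ) := by
  rw [← mul_assoc I I, I_mul_I, ofReal_exp]
  push_cast
  ring_nf

theorem exp_mul_log_scale (β : ℝ) (x : AffSemigroup) :
    Real.exp (β * Real.log (x.scale : ℕ)) = ((x.scale : ℕ) : ℝ) ^ β := by
  rw [Real.rpow_def_of_pos (by exact_mod_cast x.scale.pos), mul_comm]

theorem expectation_σ (t : ℝ) (a : Alg) : expectation (σ t a) = expectation a := by
  have h : expectation.comp (σL t) = expectation := by
    refine Alg.continuousLinearMap_ext fun x f y => ?_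
    rw [ContinuousLinearMap.comp_apply, σL_apply, isEigenvector_monomial x y f t, map_smul]
    by_cases hxy : x = y
    · subst hxy
      rw [add_zero, neg_add_cancel, ofReal_zero, mul_zero, exp_zero, one_smul]
    · rw [expectation_monomial_of_ne hxy, smul_zero]
  exact DFunLike.congr_fun h a

/-! ### A criterion for the KMS condition -/

/-- The relation `φ (a b) = c φ (b a)` for all `a`. -/
def Twisted (φ : Alg →L[ℂ] ℂ) (c : ℝ) (b : Alg) : Prop := ∀ a, φ (a * b) = c * φ (b * a)

theorem Twisted.mul {φ : Alg →L[ℂ] ℂ} {c c' : ℝ} {b b' : Alg} (h : Twisted φ c b)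
    (h' : Twisted φ c' b') : Twisted φ (c * c') (b * b') := fun a => by
  rw [← mul_assoc, h' (a * b), ← mul_assoc, h (b' * a), ofReal_mul, mul_assoc b]
  ring

/-- Along an eigenvector `b`, the function `z ↦ φ (b σ_z(a))` is a multiple of an exponential for
real `z`, hence for all `z` by the identity theorem. -/
theorem IsEigenvector.apply_mul_entireExtension {φ : Alg →L[ℂ] ℂ} (hφ : ∀ t a, φ (σ t a) = φ a)
    {l : ℝ} {b : Alg} (hb : IsEigenvector l b) {a : Alg} {F : ℂ → Alg}
    (hF : IsEntireExtension a F) (z : ℂ) : φ (b * F z) = exp (-(I * z * l)) * φ (b * a) := by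
  have h1 : Differentiable ℂ fun z => φ (b * F z) :=
    φ.differentiable.comp ((differentiable_const b).mul hF.1)
  have h2 : Differentiable ℂ fun z : ℂ => exp (-(I * z * l)) * φ (b * a) := by fun_prop
  have hreal : ∀ t : ℝ, φ (b * F t) = exp (-(I * t * l)) * φ (b * a) := fun t => by
    rw [hF.2 t, ← hφ t (b * a), map_mul (σ t), hb t, smul_mul_assoc, map_smul, smul_eq_mul,
      ← mul_assoc, ← exp_add, neg_add_cancel, exp_zero, one_mul]
  refine congrFun (AnalyticOnNhd.eq_of_frequently_eq (z₀ := 0) (fun z _ => h1.analyticAt z)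
    (fun z _ => h2.analyticAt z) ?_) z
  -- Both sides are entire and agree at the points `1 / (n + 1)`, which accumulate at `0`.
  have hlim : Filter.Tendsto (fun n : ℕ => (((1 / ((n : ℝ) + 1) : ℝ)) : ℂ)) Filter.atTop
      (nhdsWithin 0 {0}ᶜ) := by
    refine tendsto_nhdsWithin_iff.2 ⟨?_, Filter.Eventually.of_forall fun n => ?_⟩
    · exact (continuous_ofReal.tendsto' 0 0 ofReal_zero).comp
        tendsto_one_div_add_atTop_nhds_zero_nat
    · exact ofReal_ne_zero.2 (by positivity)
  exact hlim.frequently (Filter.Frequently.of_forall fun n => hreal _)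

/-- For an invariant continuous state it suffices to verify the KMS condition with a monomial as
one of the two elements. -/
theorem isKMSState_of_twisted {β : ℝ} {φ : Alg →L[ℂ] ℂ} (hstate : IsState φ)
    (hφ : ∀ t a, φ (σ t a) = φ a)
    (h : ∀ x f y, Twisted φ (((x.scale : ℕ) : ℝ) ^ (-β) * 1 * ((y.scale : ℕ) : ℝ) ^ β)
      (Alg.monomial x f y)) :
    IsKMSState β φ where
  isState := hstate
  invariant := hφ
  kms a b F _ hF _ := by
    have key : φ.comp (mulLeftL a) = φ.comp (mulRightL (F (I * β))) := by
      refine Alg.continuousLinearMap_ext fun x f y => ?_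
      rw [ContinuousLinearMap.comp_apply, ContinuousLinearMap.comp_apply,
        mulLeftL_apply, mulRightL_apply, h x f y,
        (isEigenvector_monomial x y f).apply_mul_entireExtension hφ hF, exp_neg,
        exp_I_mul_I_mul, ← ofReal_inv, ← Real.exp_neg, ← exp_mul_log_scale, ← exp_mul_log_scale,
        mul_one, ← Real.exp_add]
      congr 3
      ring
    exact DFunLike.congr_fun key b

/-- KMS states scale the projections `v x (v x)⋆`. -/
theorem IsKMSState.apply_ι_shift_one {β : ℝ} {φ : Alg →ₗ[ℂ] ℂ} (h : IsKMSState β φ)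
    (x : AffSemigroup) : φ (ι (shift x 1)) = (((x.scale : ℕ) : ℝ) ^ (-β) : ℝ) := by
  rw [← Alg.v_mul_star_v, h.kms _ _ _ _ (isEigenvector_v x).isEntireExtension
    (isEigenvector_v x).star.isEntireExtension, mul_smul_comm, Alg.star_v_mul_v, map_smul,
    h.isState.map_one, exp_I_mul_I_mul, exp_mul_log_scale, smul_eq_mul, mul_one]

theorem not_isKMSState_of_lt_one {β : ℝ} (hβ : β < 1) (φ : Alg →ₗ[ℂ] ℂ) : ¬ IsKMSState β φ := by
  intro h
  let g : C(OmegaB, ℂ) := 1 - shift ⟨0, 2⟩ 1 - shift ⟨1, 2⟩ 1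
  -- `g` is the indicator function of the complement of `(0, 2) • Ω_B ∪ (1, 2) • Ω_B`.
  have hg : star g * g = g := by
    classical
    ext ω
    have hd : ω ∈ cyl ⟨0, 2⟩ → ω ∉ cyl ⟨1, 2⟩ := fun h0 =>
      Set.disjoint_left.1 disjoint_cyl_two h0
    simp only [g, ContinuousMap.mul_apply, ContinuousMap.star_apply, ContinuousMap.sub_apply,
      ContinuousMap.one_apply, shift_one_apply]
    split_ifs with h0 h1 <;> simp_all
  have hpos := (h.isState.nonneg (ι g)).1
  rw [← map_star, ← map_mul, hg, map_sub, map_sub, map_sub, map_sub, map_one, h.isState.map_one,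
    h.apply_ι_shift_one, h.apply_ι_shift_one, sub_re, sub_re, ofReal_re, one_re] at hpos
  have h2 := one_lt_two_mul_two_rpow hβ
  norm_num at hpos
  linarith

/-! ### States given by measures -/

section MeasureState

variable (μ : Measure OmegaB) [IsProbabilityMeasure μ]

theorem integrable_continuousMap (f : C(OmegaB, ℂ)) : Integrable f μ :=
  f.continuous.integrable_of_hasCompactSupport (HasCompactSupport.of_compactSpace f)

/-- Integration against `μ`, as a continuous linear functional. -/
def integralCLM : C(OmegaB, ℂ) →L[ℂ] ℂ :=
  LinearMap.mkContinuous
    { toFun := fun f => ∫ ω, f ω ∂μ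
      map_add' := fun f g =>
        integral_add (integrable_continuousMap μ f) (integrable_continuousMap μ g)
      map_smul' := fun c f => integral_const_mul c _ }
    1 fun f => by
      have h := norm_integral_le_of_norm_le_const (μ := μ)
        (Filter.Eventually.of_forall f.norm_coe_le_norm)
      rwa [probReal_univ, mul_comm] at h

theorem integralCLM_apply (f : C(OmegaB, ℂ)) : integralCLM μ f = ∫ ω, f ω ∂μ := rfl

/-- The state `a ↦ ∫ E(a) dμ`. -/
def measureState : Alg →L[ℂ] ℂ := (integralCLM μ).comp expectation

theorem measureState_apply (a : Alg) : measureState μ a = ∫ ω, expectation a ω ∂μ := rfl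

theorem integralCLM_shift_one (x : AffSemigroup) :
    integralCLM μ (shift x 1) = μ.real (cyl x) := by
  classical
  have h : ∀ ω, shift x 1 ω = (cyl x).indicator (fun _ => (1 : ℂ)) ω := fun ω => by
    rw [shift_one_apply, Set.indicator_apply]
  rw [integralCLM_apply, integral_congr_ae (Filter.Eventually.of_forall h),
    integral_indicator (isClopen_cyl x).isOpen.measurableSet, setIntegral_const]
  simp

theorem isState_measureState : IsState (measureState μ : Alg →ₗ[ℂ] ℂ) where
  nonneg a := by
    have h : ∀ ω, expectation (star a * a) ω = ((expectation (star a * a) ω).re : ℂ) := fun ω =>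
      Complex.ext rfl (expectation_star_mul_self a ω).2
    have h1 : measureState μ (star a * a) = ((∫ ω, (expectation (star a * a) ω).re ∂μ : ℝ) : ℂ) :=
      (integral_congr_ae (Filter.Eventually.of_forall h)).trans integral_ofReal
    rw [ContinuousLinearMap.coe_coe, h1, ofReal_re, ofReal_im]
    exact ⟨integral_nonneg fun ω => (expectation_star_mul_self a ω).1, rfl⟩
  map_one := by
    have h : expectation 1 = 1 := by rw [← map_one ι, expectation_ι]
    rw [ContinuousLinearMap.coe_coe, measureState_apply, h]
    simp

theorem measureState_σ (t : ℝ) (a : Alg) : measureState μ (σ t a) = measureState μ a := by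
  rw [measureState_apply, measureState_apply, expectation_σ]

theorem expectation_star (a : Alg) : expectation (star a) = star (expectation a) := by
  refine ContinuousMap.coe_injective (denseRange_smul_origin.equalizer
    (expectation (star a)).continuous (star (expectation a)).continuous (funext fun s => ?_))
  rw [Function.comp_apply, Function.comp_apply, ContinuousMap.star_apply, expectation_smul_origin,
    expectation_smul_origin, map_star, ← inner_basisVec, ← inner_basisVec,
    ContinuousLinearMap.star_eq_adjoint, ContinuousLinearMap.adjoint_inner_right,
    ← inner_conj_symm]
  rfl

theorem measureState_star (a : Alg) : measureState μ (star a) = star (measureState μ a) := by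
  rw [measureState_apply, expectation_star]
  exact integral_conj

theorem twisted_ι (f : C(OmegaB, ℂ)) : Twisted (measureState μ) 1 (ι f) := by
  have h : (measureState μ).comp (mulRightL (ι f)) =
      (measureState μ).comp (mulLeftL (ι f)) := by
    refine Alg.continuousLinearMap_ext fun x g y => ?_
    have h1 : Alg.monomial x g y * ι f = Alg.monomial x (g * shift y f) y := by
      rw [Alg.monomial, mul_assoc, Alg.v_mul_ι, Alg.monomial, map_mul]
      simp only [mul_assoc]
    have h2 : ι f * Alg.monomial x g y = Alg.monomial x (shift x f * g) y := by
      rw [Alg.monomial, ← mul_assoc, ← mul_assoc, Alg.ι_mul_star_v, Alg.monomial, map_mul]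
      simp only [mul_assoc]
    rw [ContinuousLinearMap.comp_apply, ContinuousLinearMap.comp_apply,
      mulLeftL_apply, mulRightL_apply, h1, h2, measureState_apply, measureState_apply]
    by_cases hxy : x = y
    · subst hxy
      rw [mul_comm]
    · rw [expectation_monomial_of_ne hxy, expectation_monomial_of_ne hxy]
  intro a
  rw [ofReal_one, one_mul]
  exact DFunLike.congr_fun h a

variable {μ}

theorem twisted_v {β : ℝ} (hμ : Scaling β μ) (z : AffSemigroup) :
    Twisted (measureState μ) (((z.scale : ℕ) : ℝ) ^ β) (v z) := by
  have hz : (0 : ℝ) < ((z.scale : ℕ) : ℝ) := by exact_mod_cast z.scale.pos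
  have h : (measureState μ).comp (mulRightL (v z)) =
      (((((z.scale : ℕ) : ℝ) ^ β : ℝ)) : ℂ) •
        (measureState μ).comp (mulLeftL (v z)) := by
    refine Alg.continuousLinearMap_ext fun x g y => ?_
    obtain ⟨w, u, hwu⟩ := AffSemigroup.exists_mul_eq_mul z x
    have h1 : Alg.monomial x g y * v z = Alg.monomial x g (y * z) := by
      rw [Alg.monomial, Alg.monomial, map_mul, mul_assoc (star (v x) * ι g)]
    -- The Ore condition `w z = u x` brings `v z * (v x)⋆` into the form `(v w)⋆ * v u * ι _`.
    have h2 : v z * Alg.monomial x g y = Alg.monomial w (shift u (shift x 1 * g)) (u * y) := by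
      calc v z * Alg.monomial x g y = v z * star (v x) * ι g * v y := by
            simp only [Alg.monomial, mul_assoc]
        _ = star (v w) * (v u * ι (shift x 1 * g)) * v y := by
            rw [Alg.v_mul_star_v_of_mul_eq hwu, map_mul]
            simp only [mul_assoc]
        _ = _ := by
            rw [Alg.v_mul_ι, Alg.monomial, map_mul v]
            simp only [mul_assoc]
    rw [smul_apply, ContinuousLinearMap.comp_apply,
      ContinuousLinearMap.comp_apply, mulLeftL_apply, mulRightL_apply, h1, h2, measureState_apply,
      measureState_apply]
    by_cases hx : x = y * z
    · subst hx
      have hw : w = u * y := mul_right_cancel (hwu.trans (mul_assoc _ _ _).symm)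
      subst hw
      rw [expectation_monomial_self, expectation_monomial_self]
      have h3 : ∀ ω, pull (u * y) (shift u (shift (y * z) 1 * g)) ω =
          (cyl z).indicator (pull y g) ω := by
        classical
        intro ω
        have hmem : y • ω ∈ cyl (y * z) ↔ ω ∈ cyl z := by
          rw [← image_cyl]
          exact (smul_injective y).mem_set_image
        rw [pull_apply, mul_smul, shift_smul, ContinuousMap.mul_apply, shift_one_apply,
          Set.indicator_apply, pull_apply]
        simp only [hmem, ite_mul, one_mul, zero_mul]
      rw [integral_congr_ae (Filter.Eventually.of_forall h3),
        integral_indicator (isClopen_cyl z).isOpen.measurableSet, setIntegral_cyl hμ, smul_eq_mul,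
        ← mul_assoc, ← ofReal_mul, ← Real.rpow_add hz, add_neg_cancel, Real.rpow_zero, ofReal_one,
        one_mul]
      simp only [pull_apply, mul_smul]
    · have hw : w ≠ u * y := by
        rintro rfl
        exact hx (mul_left_cancel (hwu.symm.trans (mul_assoc _ _ _)))
      rw [expectation_monomial_of_ne hx, expectation_monomial_of_ne hw]
      simp
  exact fun a => DFunLike.congr_fun h a

theorem Twisted.star_right {c : ℝ} (hc : c ≠ 0) {b : Alg} (h : Twisted (measureState μ) c b) :
    Twisted (measureState μ) c⁻¹ (star b) := fun a => by
  have h1 := congrArg star (h (star a))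
  rw [← measureState_star, star_mul, star_star, star_mul', ← measureState_star, star_mul, star_star,
    RCLike.star_def, conj_ofReal] at h1
  rw [h1, ← mul_assoc, ← ofReal_mul, inv_mul_cancel₀ hc, ofReal_one, one_mul]

variable (μ) in
theorem isKMSState_measureState_iff (β : ℝ) :
    IsKMSState β (measureState μ : Alg →ₗ[ℂ] ℂ) ↔ Scaling β μ := by
  constructor
  · intro h
    refine scaling_iff.2 fun x => ?_
    have h1 := h.apply_ι_shift_one x
    rw [ContinuousLinearMap.coe_coe, measureState, ContinuousLinearMap.comp_apply, expectation_ι,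
      integralCLM_shift_one, ofReal_inj] at h1
    rw [← h1, ofReal_measureReal]
  · intro h
    refine isKMSState_of_twisted (isState_measureState μ) (measureState_σ μ) fun x f y => ?_
    have hx : (0 : ℝ) < ((x.scale : ℕ) : ℝ) := by exact_mod_cast x.scale.pos
    rw [Real.rpow_neg hx.le]
    exact (((twisted_v h x).star_right (by positivity)).mul (twisted_ι μ f)).mul (twisted_v h y)

end MeasureState

/-! ### Uniqueness of the KMS states factoring through the conditional expectation -/

/-- The linear span of the indicator functions of the sets `x • Ω_B`; it is a ⋆-subalgebra because
two such sets are disjoint or intersect in a third one. -/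
def cylSubalgebra : StarSubalgebra ℂ C(OmegaB, ℂ) where
  __ := Submodule.span ℂ (Set.range fun x : AffSemigroup => shift x 1)
  mul_mem' {f g} hf hg := by
    classical
    have h : Submodule.span ℂ (Set.range fun x : AffSemigroup => shift x 1) *
        Submodule.span ℂ (Set.range fun x : AffSemigroup => shift x 1) ≤
        Submodule.span ℂ (Set.range fun x : AffSemigroup => shift x 1) := by
      rw [Submodule.span_mul_span, Submodule.span_le]
      rintro _ ⟨_, ⟨x, rfl⟩, _, ⟨y, rfl⟩, rfl⟩
      change shift x 1 * shift y 1 ∈ Submodule.span ℂ _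
      rcases (cyl x ∩ cyl y).eq_empty_or_nonempty with he | hne
      · have h0 : shift x 1 * shift y 1 = 0 := by
          ext ω
          have hω : ¬ (ω ∈ cyl x ∧ ω ∈ cyl y) := fun h => Set.notMem_empty ω (he ▸ h)
          rw [ContinuousMap.mul_apply, shift_one_apply, shift_one_apply, ContinuousMap.zero_apply,
            ite_zero_mul_ite_zero, if_neg hω]
        rw [h0]
        exact zero_mem _
      · obtain ⟨z, hz⟩ := cyl_inter hne
        have h1 : shift x 1 * shift y 1 = shift z 1 := by
          ext ω
          rw [ContinuousMap.mul_apply, shift_one_apply, shift_one_apply, shift_one_apply, hz,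
            ite_zero_mul_ite_zero, mul_one]
          by_cases hω : ω ∈ cyl x ∩ cyl y
          · rw [if_pos hω, if_pos ⟨hω.1, hω.2⟩]
          · rw [if_neg hω]
            exact if_neg hω
        rw [h1]
        exact Submodule.subset_span ⟨z, rfl⟩
    exact h (Submodule.mul_mem_mul hf hg)
  algebraMap_mem' c := by
    have h : shift 1 1 = (1 : C(OmegaB, ℂ)) := by
      ext ω
      conv_lhs => rw [← one_smul AffSemigroup ω]
      exact shift_smul 1 1 ω
    rw [Algebra.algebraMap_eq_smul_one]
    exact Submodule.smul_mem _ c (Submodule.subset_span ⟨1, h⟩)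
  star_mem' {f} hf := by
    change star f ∈ Submodule.span ℂ _
    refine Submodule.span_induction (p := fun f _ => star f ∈ Submodule.span ℂ _) ?_ ?_ ?_ ?_ hf
    · rintro _ ⟨x, rfl⟩
      have h : star (shift x 1) = shift x 1 := by
        classical
        ext ω
        rw [ContinuousMap.star_apply, shift_one_apply]
        split_ifs <;> simp
      simp only [h]
      exact Submodule.subset_span ⟨x, rfl⟩
    · rw [star_zero]; exact zero_mem _
    · intro f g _ _ hf hg
      rw [star_add]
      exact add_mem hf hg
    · intro c f _ hf
      rw [star_smul]
      exact Submodule.smul_mem _ _ hf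

theorem dense_span_shift_one :
    Dense (Submodule.span ℂ (Set.range fun x : AffSemigroup => shift x 1) :
      Set C(OmegaB, ℂ)) := by
  have hsep : cylSubalgebra.SeparatesPoints := by
    classical
    intro ω ω' hne
    obtain ⟨x, hx⟩ : ∃ x, ¬ (ω ∈ cyl x ↔ ω' ∈ cyl x) :=
      not_forall.1 fun h => hne (eq_of_forall_mem_cyl h)
    refine ⟨_, ⟨shift x 1, Submodule.subset_span ⟨x, rfl⟩, rfl⟩, ?_⟩
    simp only [shift_one_apply]
    by_cases h : ω ∈ cyl x <;> by_cases h' : ω' ∈ cyl x <;> simp_all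
  have h := ContinuousMap.starSubalgebra_topologicalClosure_eq_top_of_separatesPoints
    cylSubalgebra hsep
  intro f
  have hf : f ∈ cylSubalgebra.topologicalClosure := h ▸ trivial
  exact hf

open scoped ComplexOrder in
/-- States are continuous on `C(Ω_B)`. -/
theorem IsState.continuous_ι {φ : Alg →ₗ[ℂ] ℂ} (h : IsState φ) :
    Continuous fun f : C(OmegaB, ℂ) => φ (ι f) := by
  let ψ : C(OmegaB, ℂ) →ₚ[ℂ] ℂ :=
    PositiveLinearMap.mk₀ (φ.comp (ι : C(OmegaB, ℂ) →⋆ₐ[ℂ] Alg).toAlgHom.toLinearMap) fun f hf => by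
      obtain ⟨g, rfl⟩ := CStarAlgebra.nonneg_iff_eq_star_mul_self.1 hf
      have hg := h.nonneg (ι g)
      rw [← map_star, ← map_mul] at hg
      exact Complex.nonneg_iff.2 ⟨hg.1, hg.2.symm⟩
  exact map_continuous ψ

theorem IsKMSState.eq_measureState {β : ℝ} {φ : Alg →ₗ[ℂ] ℂ} (hφ : IsKMSState β φ)
    (hE : FactorsThrough expectation φ) {μ : Measure OmegaB} [IsProbabilityMeasure μ]
    (hμ : Scaling β μ) : φ = measureState μ := by
  obtain ⟨ψ, hψ⟩ := hE
  have hψι : ∀ f, ψ f = φ (ι f) := fun f => by rw [hψ, expectation_ι]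
  let T : C(OmegaB, ℂ) →L[ℂ] ℂ :=
    ⟨φ.comp (ι : C(OmegaB, ℂ) →⋆ₐ[ℂ] Alg).toAlgHom.toLinearMap, hφ.isState.continuous_ι⟩
  have hT : T = integralCLM μ := by
    refine ContinuousLinearMap.ext_on dense_span_shift_one ?_
    rintro _ ⟨x, rfl⟩
    refine (hφ.apply_ι_shift_one x).trans ?_
    rw [integralCLM_shift_one, Measure.real, scaling_iff.1 hμ,
      ENNReal.toReal_ofReal (by positivity)]
  refine LinearMap.ext fun a => ?_
  rw [hψ, hψι]
  exact DFunLike.congr_fun hT (expectation a)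

end AffineBC
end

open AffineBC in
theorem proposition2p1 :
    -- measures satisfying the scaling condition
    (∀ β : ℝ, 1 ≤ β → ∃! μ : Measure OmegaB, IsProbabilityMeasure μ ∧ OmegaB.Scaling β μ) ∧
    (∀ β : ℝ, β < 1 → ¬ ∃ μ : Measure OmegaB, IsProbabilityMeasure μ ∧ OmegaB.Scaling β μ) ∧
    -- their description by the symmetric Bost–Connes measures
    (∀ β : ℝ, 1 ≤ β → ∀ ν : Measure SupNat,
      (IsProbabilityMeasure ν ∧ SupNat.Scaling (β - 1) ν) ↔ ν = symBostConnes (β - 1)) ∧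
    (∀ β : ℝ, 1 ≤ β → ∀ μ : Measure OmegaB, IsProbabilityMeasure μ → OmegaB.Scaling β μ →
      μ = (haarZHat.prod (symBostConnes (β - 1))).map OmegaB.proj) ∧
    -- the canonical conditional expectation
    (∃! E : Alg →L[ℂ] C(OmegaB, ℂ), CrossedProduct.IsCanonicalExpectation E) ∧
    ∀ E : Alg →L[ℂ] C(OmegaB, ℂ), CrossedProduct.IsCanonicalExpectation E →
      -- the correspondence between measures and states
      (∀ (β : ℝ) (μ : Measure OmegaB), IsProbabilityMeasure μ → ∀ φ : Alg →ₗ[ℂ] ℂ,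
        (∀ a, φ a = ∫ ω, E a ω ∂μ) → (IsKMSState β φ ↔ OmegaB.Scaling β μ)) ∧
      -- KMS-states
      (∀ β : ℝ, 1 ≤ β → ∃! φ : Alg →ₗ[ℂ] ℂ, IsKMSState β φ ∧ FactorsThrough E φ) ∧
      (∀ β : ℝ, β < 1 → ¬ ∃ φ : Alg →ₗ[ℂ] ℂ, IsKMSState β φ) := by
  refine ⟨fun β hβ => ?_, ?_, fun β hβ ν => ?_, fun β hβ μ _ h => ?_, ?_, ?_⟩
  · have hprob := OmegaB.isProbabilityMeasure_scalingMeasure hβ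
    refine ⟨OmegaB.scalingMeasure β, ⟨hprob, OmegaB.scaling_scalingMeasure hβ⟩, ?_⟩
    rintro μ ⟨_, h⟩
    exact OmegaB.scaling_unique h (OmegaB.scaling_scalingMeasure hβ)
  · rintro β hβ ⟨μ, _, h⟩
    exact OmegaB.not_scaling_of_lt_one hβ μ h
  · have hprob := isProbabilityMeasure_symBostConnes (sub_nonneg.2 hβ)
    have hscal := scaling_symBostConnes (sub_nonneg.2 hβ)
    constructor
    · rintro ⟨_, h⟩
      exact SupNat.scaling_unique h hscal
    · rintro rfl
      exact ⟨hprob, hscal⟩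
  · have hprob := OmegaB.isProbabilityMeasure_scalingMeasure hβ
    exact OmegaB.scaling_unique (ν := OmegaB.scalingMeasure β) h (OmegaB.scaling_scalingMeasure hβ)
  · exact ⟨expectation, isCanonicalExpectation_expectation, fun E hE => eq_expectation hE⟩
  · intro E hE
    obtain rfl := eq_expectation hE
    refine ⟨fun β μ _ φ hφ => ?_, fun β hβ => ?_, ?_⟩
    · have h : φ = measureState μ := LinearMap.ext hφ
      rw [h]
      exact isKMSState_measureState_iff μ β
    · have hprob := OmegaB.isProbabilityMeasure_scalingMeasure hβ
      have hscal := OmegaB.scaling_scalingMeasure hβ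
      refine ⟨measureState (OmegaB.scalingMeasure β),
        ⟨(isKMSState_measureState_iff _ β).2 hscal, integralCLM _, fun a => rfl⟩, ?_⟩
      rintro φ ⟨hφ, hfac⟩
      exact hφ.eq_measureState hfac hscal
    · rintro β hβ ⟨φ, hφ⟩
      exact not_isKMSState_of_lt_one hβ φ hφ
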